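/- Let $q\ge 1$ and let $\phi=(\phi_1,\dots,\phi_q):[0,1]\to\mathbb{R}^q$ be such that each $\phi_k$ is Lipschitz continuous with support $\mathcal{T}_k$ a compact subset of $(0,1)$, $\int_0^1\phi_k(u)\,du=0$, $\int_0^1\phi_k(u)^2\,du=1$, and $\phi_1,\dots,\phi_q$ are linearly independent. Put $\tau_{\min}=\inf\bigcup_k\mathcal{T}_k$, $\tau_{\max}=\sup\bigcup_k\mathcal{T}_k$, and $\Sigma_{k,s}=\int_0^1\phi_k(u)\phi_s(u)\,du$ for $1\le k,s\le q$. Let $\mathcal{P}_0$ be a set of probability distributions $P$ of $(X,Y,Z)$ on $[0,1]\times[0,1]\times[0,1]^d$ that are absolutely continuous with respect to Lebesgue measure. For each $P\in\mathcal{P}_0$ fix versions of the conditional distributions of $X$ given $Z=z$ and of $Y$ given $Z=z$, $z\in[0,1]^d$, all of which are continuous (have no atoms), with distribution functions $F_{X\mid Z}(t\mid z)=P(X\le t\mid Z=z)$ and $F_{Y\mid Z}(t\mid z)=P(Y\le t\mid Z=z)$. Let $Q_{X\mid Z}(\tau\mid z)=\inf\{t\in[0,1]: F_{X\mid Z}(t\mid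 z)\ge\tau\}$ and, for $f:[0,1]\times[0,1]^d\to\mathbb{R}$, $$\|f\|_{\mathcal{T},\infty}=\sup_{z\in[0,1]^d}\ \sup_{t\in[Q_{X\mid Z}(\tau_{\min}\mid z),\,Q_{X\mid Z}(\tau_{\max}\mid z)]}|f(t,z)|,\qquad \|f\|_{\mathcal{T}^c,\infty}=\sup_{z\in[0,1]^d}\ \sup_{t\in[0,1]\setminus[Q_{X\mid Z}(\tau_{\min}\mid z),\,Q_{X\mid Z}(\tau_{\max}\mid z)]}|f(t,z)|,$$ and let $\|\cdot\|'_{\mathcal{T},\infty}$, $\|\cdot\|'_{\mathcal{T}^c,\infty}$ be defined in the same way with $Y$ in place of $X$. (These norms depend on $P$.) Let $\mathcal{H}_0\subseteq\mathcal{P}_0$ be the set of $P\in\mathcal{P}_0$ under which $X$ and $Y$ are conditionally independent given $Z$, and assume $\mathcal{H}_0\neq\emptyset$. Let $(X_i,Y_i,Z_i)_{i=1}^n$ be an i.i.d. sample from $P$. Let $\hat F^{(n)}_{X\mid Z}$ be an estimator computed from $(X_i,Z_i)_{i=1}^n$ and $\hat F^{(n)}_{Y\mid Z}$ an estimator computed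 from $(Y_i,Z_i)_{i=1}^n$: each is a measurable map from the respective sample to functions $\hat F(\cdot\mid z):[0,1]\to[0,1]$ that are, for every $z\in[0,1]^d$, continuous and increasing (i.e. nondecreasing) with $\hat F(0\mid z)=0$, $\hat F(1\mid z)=1$. Set $\hat U_{1,i}=\hat F^{(n)}_{X\mid Z}(X_i\mid Z_i)$, $\hat U_{2,i}=\hat F^{(n)}_{Y\mid Z}(Y_i\mid Z_i)$, $$\hat\rho_n=\frac1n\sum_{i=1}^n\phi(\hat U_{1,i})\phi(\hat U_{2,i})^T,\qquad T_n=\big\|\Sigma^{-1/2}\hat\rho_n\Sigma^{-1/2}\big\|_F^2,$$ where $\|\cdot\|_F$ is the Frobenius norm, and for $\alpha\in(0,1)$ let $\hat\Psi_n=1(T_n>n^{-1}z_{1-\alpha})$, where $z_{1-\alpha}$ is the $(1-\alpha)$-quantile of the $\chi^2$ distribution with $q^2$ degrees of freedom. For a deterministic sequence $(a_n)$ of non-zero reals, write $W_n\in\mathcal{O}_{\mathcal{P}_0}(a_n)$ if for every $\epsilon>0$ there is $M>0$ with $\sup_{n\ge1}\sup_{P\in\mathcal{P}_0}P(|W_n/a_n|>M)<\epsilon$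 (outer probability if the event is not measurable). Suppose there are deterministic non-zero rate functions $g,h$ with $g(n)\to0$, $h(n)\to0$ and $\sqrt n\,g(n)h(n)\to0$ as $n\to\infty$, and, for each $P\in\mathcal{P}_0$, functions $\xi=\xi_P$, $\xi'=\xi'_P:[0,1]\times[0,1]^d\to\mathbb{R}$, such that (i) $\|F_{X\mid Z}-\hat F^{(n)}_{X\mid Z}\|_{\mathcal{T},\infty}\in\mathcal{O}_{\mathcal{P}_0}(g(n))$ and $\|F_{Y\mid Z}-\hat F^{(n)}_{Y\mid Z}\|'_{\mathcal{T},\infty}\in\mathcal{O}_{\mathcal{P}_0}(h(n))$; (ii) $\|\xi-\hat F^{(n)}_{X\mid Z}\|_{\mathcal{T}^c,\infty}\in\mathcal{O}_{\mathcal{P}_0}(g(n))$ and $\|\xi'-\hat F^{(n)}_{Y\mid Z}\|'_{\mathcal{T}^c,\infty}\in\mathcal{O}_{\mathcal{P}_0}(h(n))$. Then the test $\hat\Psi_n$ has asymptotic uniform level over $\mathcal{H}_0$: $$\limsup_{n\to\infty}\ \sup_{P\in\mathcal{H}_0}E_P(\hat\Psi_n)=\alpha.$$ -/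

import Mathlib

open MeasureTheory ProbabilityTheory Filter Topology
open scoped unitInterval ENNReal NNReal

noncomputable section

namespace PartialCopula

/-- The hypercube `[0,1]^(2+d)`, in which a single observation `(X, Y, Z)` takes its values;
its `volume` is Lebesgue measure. -/
abbrev Obs (d : ℕ) : Type := I × I × (Fin d → I)

/-- The coordinate `X`. -/
def obsX {d : ℕ} (w : Obs d) : I := w.1

/-- The coordinate `Y`. -/
def obsY {d : ℕ} (w : Obs d) : I := w.2.1

/-- The coordinate `Z`. -/
def obsZ {d : ℕ} (w : Obs d) : Fin d → I := w.2.2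

lemma measurable_obsZ {d : ℕ} : Measurable (obsZ : Obs d → Fin d → I) :=
  measurable_snd.comp measurable_snd

/-- The law of an i.i.d. sample of size `n` from `P`. -/
def iidLaw {d : ℕ} (P : ProbabilityMeasure (Obs d)) (n : ℕ) : Measure (Fin n → Obs d) :=
  Measure.pi fun _ => (P : Measure (Obs d))

/-- `𝓗₀`: the members of `P₀` under which `X` and `Y` are conditionally independent given `Z`. -/
def nullHyp {d : ℕ} (P₀ : Set (ProbabilityMeasure (Obs d))) : Set (ProbabilityMeasure (Obs d)) :=
  {P | P ∈ P₀ ∧ CondIndepFun (MeasurableSpace.comap (obsZ : Obs d → Fin d → I) inferInstance)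
    measurable_obsZ.comap_le obsX obsY (P : Measure (Obs d))}

/-- `κ` is a version of the conditional distribution of the coordinate `V` given `Z` under `P`,
and the distribution `κ z` is continuous (has no atoms) for every `z`. -/
structure IsContCondDistrib {d : ℕ} (P : ProbabilityMeasure (Obs d)) (V : Obs d → I)
    (κ : Kernel (Fin d → I) I) : Prop where
  markov : IsMarkovKernel κ
  condDistrib : HasCondDistrib V obsZ κ (P : Measure (Obs d))
  continuous : ∀ z t, κ z {t} = 0

/-- The conditional distribution function `F(t | z)` of a conditional distribution `κ`. -/
def condDF {d : ℕ} (κ : Kernel (Fin d → I) I) (t : I) (z : Fin d → I) : ℝ :=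
  (κ z).real (Set.Iic t)

/-- The conditional quantile function `Q(τ | z) = inf {t ∈ [0,1] | F(t | z) ≥ τ}`. -/
def condQuantile {d : ℕ} (κ : Kernel (Fin d → I) I) (τ : ℝ) (z : Fin d → I) : ℝ :=
  sInf ((fun t : I => (t : ℝ)) '' {t : I | τ ≤ condDF κ t z})

/-- `Q(𝓣 | z) = [Q(τmin | z), Q(τmax | z)]` for `𝓣 = [τmin, τmax]`. -/
def quantileRange {d : ℕ} (κ : Kernel (Fin d → I) I) (τmin τmax : ℝ) (z : Fin d → I) : Set I :=
  {t : I | (t : ℝ) ∈ Set.Icc (condQuantile κ τmin z) (condQuantile κ τmax z)}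

/-- `sup_z sup_{t ∈ S z} |f(t, z)|`, as an extended nonnegative number. -/
def supNormOn {d : ℕ} (S : (Fin d → I) → Set I) (f : I → (Fin d → I) → ℝ) : ℝ≥0∞ :=
  ⨆ z, ⨆ t ∈ S z, ENNReal.ofReal |f t z|

/-- An estimator of a conditional distribution function given `Z`: for each sample size, a
measurable map from a sample `(Xᵢ, Zᵢ)ᵢ` to a function `(t, z) ↦ F̂(t | z)` with values in `[0,1]`
that is continuous and increasing in `t`, with value `0` at `t = 0` and `1` at `t = 1`. -/
structure CDFEstimator (d : ℕ) where
  toFun : (n : ℕ) → (Fin n → I × (Fin d → I)) → I → (Fin d → I) → I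
  measurable : ∀ n, Measurable fun p : (Fin n → I × (Fin d → I)) × I × (Fin d → I) =>
    toFun n p.1 p.2.1 p.2.2
  continuous : ∀ n s z, Continuous fun t => toFun n s t z
  monotone : ∀ n s z, Monotone fun t => toFun n s t z
  map_zero : ∀ n s z, toFun n s 0 z = 0
  map_one : ∀ n s z, toFun n s 1 z = 1

/-- The estimate `F̂^(n)` of the conditional distribution function of the coordinate `V` given `Z`,
computed from the pairs `(Vᵢ, Zᵢ)` of the sample. -/
def CDFEstimator.fit {d : ℕ} (E : CDFEstimator d) (V : Obs d → I) {n : ℕ} (s : Fin n → Obs d) :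
    I → (Fin d → I) → I :=
  E.toFun n fun i => (V (s i), obsZ (s i))

/-- The random variables `W n` (functions of the sample of size `n`, possibly depending on `P`)
are big-O of `a n` in probability, uniformly over `M`. -/
def IsUniformBigO {d : ℕ} (M : Set (ProbabilityMeasure (Obs d)))
    (W : ProbabilityMeasure (Obs d) → (n : ℕ) → (Fin n → Obs d) → ℝ≥0∞) (a : ℕ → ℝ) : Prop :=
  ∀ ε : ℝ, 0 < ε → ∃ C : ℝ, 0 < C ∧
    (⨆ (n : ℕ) (_ : 1 ≤ n), ⨆ P ∈ M,
      iidLaw P n {s | ENNReal.ofReal C < W P n s / ENNReal.ofReal |a n|}) < ENNReal.ofReal ε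

/-- The standing assumptions on `φ = (φ₁, …, φ_q) : [0,1] → ℝ^q`. -/
structure IsScoreMap {q : ℕ} (φ : Fin q → I → ℝ) : Prop where
  support : ∀ k, tsupport (φ k) ⊆ Set.Ioo 0 1
  lipschitz : ∀ k, ∃ L : ℝ≥0, LipschitzWith L (φ k)
  integral_eq_zero : ∀ k, ∫ u, φ k u = 0
  integral_sq_eq_one : ∀ k, ∫ u, φ k u ^ 2 = 1
  linearIndependent : LinearIndependent ℝ φ

/-- The union of the supports of `φ₁, …, φ_q`, as a set of real numbers. -/
def supportUnion {q : ℕ} (φ : Fin q → I → ℝ) : Set ℝ :=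
  (fun u : I => (u : ℝ)) '' ⋃ k, tsupport (φ k)

/-- The lowest quantile level in the supports. -/
def tauMin {q : ℕ} (φ : Fin q → I → ℝ) : ℝ := sInf (supportUnion φ)

/-- The highest quantile level in the supports. -/
def tauMax {q : ℕ} (φ : Fin q → I → ℝ) : ℝ := sSup (supportUnion φ)

/-- Uniform consistency over `P₀` with rate `g` of the estimator `E` of the conditional
distribution function of the coordinate `V` given `Z`; `κ P` is the conditional distribution
under `P`. On the conditional `𝓣`-quantiles the estimator is consistent; off them it converges to
some limit function `ξ P`. Here `𝓣 = [tauMin φ, tauMax φ]`. -/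
structure UniformlyConsistent {d q : ℕ} (φ : Fin q → I → ℝ)
    (P₀ : Set (ProbabilityMeasure (Obs d))) (V : Obs d → I)
    (κ : ProbabilityMeasure (Obs d) → Kernel (Fin d → I) I) (E : CDFEstimator d)
    (g : ℕ → ℝ) : Prop where
  rate_ne_zero : ∀ n, 1 ≤ n → g n ≠ 0
  rate_tendsto : Tendsto g atTop (𝓝 0)
  consistent : IsUniformBigO P₀
    (fun P _ s => supNormOn (quantileRange (κ P) (tauMin φ) (tauMax φ))
      fun t z => condDF (κ P) t z - (E.fit V s t z : ℝ)) g
  tail : ∃ ξ : ProbabilityMeasure (Obs d) → I → (Fin d → I) → ℝ, IsUniformBigO P₀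
    (fun P _ s => supNormOn (fun z => (quantileRange (κ P) (tauMin φ) (tauMax φ) z)ᶜ)
      fun t z => ξ P t z - (E.fit V s t z : ℝ)) g

/-- `Σ_{k,s} = ∫₀¹ φ_k(u) φ_s(u) du`. -/
def covMatrix {q : ℕ} (φ : Fin q → I → ℝ) : Matrix (Fin q) (Fin q) ℝ :=
  Matrix.of fun k s => ∫ u, φ k u * φ s u

open scoped MatrixOrder in
/-- `Σ^(-1/2)`, the inverse of the positive semidefinite square root of `Σ`. -/
def covMatrixInvSqrt {q : ℕ} (φ : Fin q → I → ℝ) : Matrix (Fin q) (Fin q) ℝ :=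
  (CFC.sqrt (covMatrix φ))⁻¹

/-- `ρ_n((uᵢ, vᵢ)ᵢ) = n⁻¹ ∑ᵢ φ(uᵢ) φ(vᵢ)ᵀ`. -/
def empCorr {q : ℕ} (φ : Fin q → I → ℝ) {n : ℕ} (uv : Fin n → I × I) :
    Matrix (Fin q) (Fin q) ℝ :=
  Matrix.of fun k l => (n : ℝ)⁻¹ * ∑ i, φ k (uv i).1 * φ l (uv i).2

/-- The estimated nonparametric residuals `(Û₁ᵢ, Û₂ᵢ)`. -/
def residuals {d : ℕ} (EX EY : CDFEstimator d) {n : ℕ} (s : Fin n → Obs d) (i : Fin n) : I × I :=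
  (EX.fit obsX s (obsX (s i)) (obsZ (s i)), EY.fit obsY s (obsY (s i)) (obsZ (s i)))

/-- The squared Frobenius norm. -/
def frobeniusSq {q : ℕ} (A : Matrix (Fin q) (Fin q) ℝ) : ℝ := ∑ k, ∑ l, A k l ^ 2

/-- The test statistic `T_n = ‖Σ^(-1/2) ρ̂_n Σ^(-1/2)‖_F²`. -/
def testStat {d q : ℕ} (φ : Fin q → I → ℝ) (EX EY : CDFEstimator d) {n : ℕ}
    (s : Fin n → Obs d) : ℝ :=
  frobeniusSq (covMatrixInvSqrt φ * empCorr φ (residuals EX EY s) * covMatrixInvSqrt φ)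

/-- The `χ²` distribution with `m` degrees of freedom: the law of the sum of squares of `m`
independent standard normal variables. -/
def chiSq (m : ℕ) : Measure ℝ :=
  (Measure.pi fun _ : Fin m => gaussianReal 0 1).map fun x => ∑ i, x i ^ 2

/-- The `p`-quantile of a distribution on the real line. -/
def quantile (μ : Measure ℝ) (p : ℝ) : ℝ := sInf {x | p ≤ cdf μ x}

open scoped Classical in
/-- The test `Ψ̂_n = 1(T_n > n⁻¹ z_{1-α})`, with `z_{1-α}` the `(1-α)`-quantile of the
`χ²` distribution with `q²` degrees of freedom. -/
def test {d q : ℕ} (φ : Fin q → I → ℝ) (EX EY : CDFEstimator d) (α : ℝ) {n : ℕ}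
    (s : Fin n → Obs d) : ℝ :=
  if (n : ℝ)⁻¹ * quantile (chiSq (q ^ 2)) (1 - α) < testStat φ EX EY s then 1 else 0

end PartialCopula

end

open PartialCopula

noncomputable section

namespace PartialCopula

/-! ### Distribution functions, quantiles and the probability integral transform. -/

section DistributionFunctions

/-! With the standardized scores `ψ = Σ^(-1/2) φ`, the test rejects exactly when `‖S_n‖ > √z`, where
`S_n` is `n^(-1/2)` times the sum of the tensors of all products `ψ_k(Û₁ᵢ) ψ_l(Û₂ᵢ)`
(`frobeniusSq_standardized_empCorr`, `integral_test_eq`). Compare `S_n` with the oracle sum built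
from the true residuals `F(X | Z)` and `F(Y | Z)`.

Under the null hypothesis the true residuals are uniform on the unit square
(`map_residuals_eq_volume`). The law of the oracle sum is therefore the same for every `P`, so one
application of the central limit theorem is automatically uniform in `P`. The summands are centered
with identity covariance, the limit is standard Gaussian in dimension `q²`, and its squared norm is
`χ²`.

Let `a` and `b` be the errors of `ψ_k(Û₁)` and `ψ_l(Û₂)`. The difference of products is `ψ_k(U₁) b +
ψ_l(U₂) a + a b`. The last term contributes at most `√n` times the product of the sup errors, which
is of order `√n g h → 0`. In the first, `b` depends only on the pairs `(Yᵢ, Zᵢ)`, while `U₁` is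
independent of `(Y, Z)` by `map_condPIT_eq_prod`. Given these pairs the sum is centered with
variance at most `(sup |b|)²`, so consistency at any rate is enough
(`measure_pi_lt_abs_sum_mul_le`); the second is symmetric. The sup errors are controlled by
`abs_sub_le_of_supNormOn_le`: the scores vanish outside `(τmin, τmax)`, and monotonicity of the
estimate limits its error there. -/

lemma continuous_measureReal_Iic {α : Type*} [LinearOrder α] [TopologicalSpace α]
    [OrderTopology α] [FirstCountableTopology α] [MeasurableSpace α] [OpensMeasurableSpace α]
    (μ : Measure α) [IsFiniteMeasure μ] (hμ : ∀ t, μ {t} = 0) :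
    Continuous fun t => μ.real (Set.Iic t) := by
  have h : (fun t => μ.real (Set.Iic t)) =
      fun t => ∫ x, (Set.Iic t).indicator (fun _ => (1 : ℝ)) x ∂μ := by
    ext t
    rw [integral_indicator measurableSet_Iic]
    simp
  rw [h, continuous_iff_continuousAt]
  intro t₀
  refine continuousAt_of_dominated (bound := fun _ => 1) ?_ ?_ (integrable_const _) ?_
  · exact .of_forall fun t => (measurable_const.indicator measurableSet_Iic).aestronglyMeasurable
  · refine .of_forall fun t => .of_forall fun x => ?_
    by_cases hx : x ∈ Set.Iic t <;> simp [hx]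
  · have : ∀ᵐ x ∂μ, x ≠ t₀ := by
      rw [ae_iff]
      simpa using hμ t₀
    filter_upwards [this] with x hx
    rcases lt_or_gt_of_ne hx with hlt | hgt
    · refine (continuousAt_const (y := (1 : ℝ))).congr ?_
      filter_upwards [eventually_gt_nhds hlt] with t ht
      simp [ht.le]
    · refine (continuousAt_const (y := (0 : ℝ))).congr ?_
      filter_upwards [eventually_lt_nhds hgt] with t ht
      simp [ht]

lemma monotone_measureReal_Iic {α : Type*} [Preorder α] [MeasurableSpace α]
    (μ : Measure α) [IsFiniteMeasure μ] : Monotone fun t => μ.real (Set.Iic t) :=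
  fun _ _ h => measureReal_mono (Set.Iic_subset_Iic.2 h)

/-- The probability integral transform of a distribution on the unit interval. -/
def probIntegralTransform (μ : Measure I) [IsProbabilityMeasure μ] (t : I) : I :=
  ⟨μ.real (Set.Iic t), measureReal_nonneg, measureReal_le_one⟩

lemma continuous_probIntegralTransform (μ : Measure I) [IsProbabilityMeasure μ]
    (hμ : ∀ t, μ {t} = 0) : Continuous (probIntegralTransform μ) :=
  (continuous_measureReal_Iic μ hμ).subtype_mk _

lemma monotone_probIntegralTransform (μ : Measure I) [IsProbabilityMeasure μ] :
    Monotone (probIntegralTransform μ) :=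
  fun _ _ h => monotone_measureReal_Iic μ h

lemma probIntegralTransform_surjective (μ : Measure I) [IsProbabilityMeasure μ]
    (hμ : ∀ t, μ {t} = 0) : Function.Surjective (probIntegralTransform μ) := by
  intro u
  have h0 : probIntegralTransform μ 0 = 0 := by
    ext
    have : Set.Iic (0 : I) = {0} := by ext x; simp
    simp [probIntegralTransform, this, measureReal_def, hμ]
  have h1 : probIntegralTransform μ 1 = 1 := by
    ext
    have : Set.Iic (1 : I) = Set.univ := Set.eq_univ_of_forall fun x => x.2.2
    simp [probIntegralTransform, this]
  have := intermediate_value_univ (0 : I) 1 (continuous_probIntegralTransform μ hμ)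
  rw [h0, h1] at this
  exact this ⟨u.2.1, u.2.2⟩

lemma volume_Iic_unitInterval (u : I) : (volume : Measure I) (Set.Iic u) = ENNReal.ofReal u := by
  rw [unitInterval.volume_apply]
  have : Subtype.val '' Set.Iic u = Set.Icc (0 : ℝ) u := by
    ext x
    constructor
    · rintro ⟨y, hy, rfl⟩
      exact ⟨y.2.1, hy⟩
    · rintro ⟨h0, h1⟩
      exact ⟨⟨x, h0, h1.trans u.2.2⟩, h1, rfl⟩
  rw [this, Real.volume_Icc, sub_zero]

lemma map_probIntegralTransform (μ : Measure I) [IsProbabilityMeasure μ]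
    (hμ : ∀ t, μ {t} = 0) : μ.map (probIntegralTransform μ) = volume := by
  have hc := continuous_probIntegralTransform μ hμ
  have : IsProbabilityMeasure (μ.map (probIntegralTransform μ)) :=
    Measure.isProbabilityMeasure_map hc.measurable.aemeasurable
  refine Measure.ext_of_Iic _ _ fun u => ?_
  rw [Measure.map_apply hc.measurable measurableSet_Iic, volume_Iic_unitInterval]
  -- The preimage of `[0, u]` is an initial segment `[0, m]`. Since `u` is attained, `F(m) = u`, so
  -- the segment has mass `u`.
  obtain ⟨t₀, ht₀⟩ := probIntegralTransform_surjective μ hμ u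
  obtain ⟨m, hm, hmax⟩ := ((isClosed_Iic (a := u)).preimage hc).isCompact.exists_isGreatest
    ⟨t₀, ht₀.le⟩
  have hset : probIntegralTransform μ ⁻¹' Set.Iic u = Set.Iic m := by
    ext x
    exact ⟨fun hx => hmax hx, fun hx => (monotone_probIntegralTransform μ hx).trans hm⟩
  have hval : probIntegralTransform μ m = u :=
    le_antisymm hm (ht₀.ge.trans (monotone_probIntegralTransform μ (hmax ht₀.le)))
  rw [hset, ← hval]
  simp [probIntegralTransform]

/-- An atomless distribution on the real line takes the value `p` at its `p`-quantile. -/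
lemma cdf_quantile (μ : Measure ℝ) [IsProbabilityMeasure μ] (hμ : ∀ t, μ {t} = 0) {p : ℝ}
    (hp : p ∈ Set.Ioo (0 : ℝ) 1) : cdf μ (quantile μ p) = p := by
  have hc : Continuous (cdf μ) := by
    have := continuous_measureReal_Iic μ hμ
    convert this using 1
    ext t
    exact cdf_eq_real μ t
  obtain ⟨a, ha⟩ := ((tendsto_cdf_atBot μ).eventually (gt_mem_nhds hp.1)).exists
  obtain ⟨b, hb⟩ := ((tendsto_cdf_atTop μ).eventually (lt_mem_nhds hp.2)).exists
  obtain ⟨x, hx⟩ := mem_range_of_exists_le_of_exists_ge hc ⟨a, ha.le⟩ ⟨b, hb.le⟩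
  have hbdd : BddBelow {x | p ≤ cdf μ x} :=
    ⟨a, fun y hy => le_of_lt ((cdf μ).mono.reflect_lt (ha.trans_le hy))⟩
  have hne : {x | p ≤ cdf μ x}.Nonempty := ⟨x, hx.ge⟩
  refine le_antisymm ?_ ((isClosed_Ici.preimage hc).csInf_mem hne hbdd)
  exact ((cdf μ).mono (csInf_le hbdd hx.ge)).trans hx.le

variable {d : ℕ}

/-- By continuity and compactness the infimum defining the quantile is attained, at a point where
the distribution function equals `τ` exactly. -/
lemma exists_condQuantile_eq {κ : Kernel (Fin d → I) I} [IsMarkovKernel κ]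
    (hκ : ∀ z t, κ z {t} = 0) {τ : ℝ} (hτ : τ ∈ I) (z : Fin d → I) :
    ∃ a : I, (a : ℝ) = condQuantile κ τ z ∧ condDF κ a z = τ ∧
      ∀ t, τ ≤ condDF κ t z → a ≤ t := by
  have hc : Continuous fun t => condDF κ t z := continuous_measureReal_Iic (κ z) (hκ z)
  have hm : Monotone fun t => condDF κ t z := monotone_measureReal_Iic (κ z)
  obtain ⟨t₀, ht₀⟩ := probIntegralTransform_surjective (κ z) (hκ z) ⟨τ, hτ⟩
  have ht₀' : condDF κ t₀ z = τ := congrArg Subtype.val ht₀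
  obtain ⟨a, ha, hmin⟩ := ((isClosed_Ici (a := τ)).preimage hc).isCompact.exists_isLeast
    ⟨t₀, ht₀'.ge⟩
  refine ⟨a, ?_, le_antisymm ((hm (hmin ht₀'.ge)).trans ht₀'.le) ha, fun t ht => hmin ht⟩
  have : IsLeast ((fun t : I => (t : ℝ)) '' {t : I | τ ≤ condDF κ t z}) a := by
    refine ⟨⟨a, ha, rfl⟩, ?_⟩
    rintro _ ⟨t, ht, rfl⟩
    exact hmin ht
  exact this.csInf_eq.symm

lemma condQuantile_mono_level {κ : Kernel (Fin d → I) I} [IsMarkovKernel κ]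
    (hκ : ∀ z t, κ z {t} = 0) {τ τ' : ℝ} (h : τ ≤ τ') (hτ : τ ∈ I) (hτ' : τ' ∈ I)
    (z : Fin d → I) : condQuantile κ τ z ≤ condQuantile κ τ' z := by
  obtain ⟨a, ha, -, hmin⟩ := exists_condQuantile_eq hκ hτ z
  obtain ⟨b, hb, hFb, -⟩ := exists_condQuantile_eq hκ hτ' z
  rw [← ha, ← hb]
  exact hmin b (h.trans hFb.ge)

lemma abs_le_of_supNormOn_le {S : (Fin d → I) → Set I} {f : I → (Fin d → I) → ℝ} {c : ℝ}
    (hc : 0 ≤ c) (h : supNormOn S f ≤ ENNReal.ofReal c) {z : Fin d → I} {t : I} (ht : t ∈ S z) :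
    |f t z| ≤ c := by
  have : ENNReal.ofReal |f t z| ≤ supNormOn S f :=
    le_iSup_of_le z (le_iSup₂_of_le t ht le_rfl)
  exact (ENNReal.ofReal_le_ofReal_iff hc).1 (this.trans h)

/-- If `ψ` is Lipschitz and vanishes off `[τ₀, τ₁]`, then an approximation of a conditional
distribution function on the conditional quantile range of `[τ₀, τ₁]` by an increasing function
yields an approximation after composition with `ψ` everywhere. -/
lemma abs_sub_le_of_supNormOn_le {κ : Kernel (Fin d → I) I} [IsMarkovKernel κ]
    (hκ : ∀ z t, κ z {t} = 0) {τ₀ τ₁ : ℝ} (h₀₁ : τ₀ ≤ τ₁) (hτ₀ : τ₀ ∈ I) (hτ₁ : τ₁ ∈ I)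
    {ψ : I → ℝ} {L : ℝ≥0} (hψ : LipschitzWith L ψ) (hlo : ∀ u : I, (u : ℝ) ≤ τ₀ → ψ u = 0)
    (hhi : ∀ u : I, τ₁ ≤ u → ψ u = 0) {G : I → (Fin d → I) → I} (hG : ∀ z, Monotone fun t => G t z)
    {c : ℝ} (hc : 0 ≤ c)
    (h : supNormOn (quantileRange κ τ₀ τ₁) (fun t z => condDF κ t z - G t z) ≤ ENNReal.ofReal c)
    (t : I) (z : Fin d → I) :
    |ψ (G t z) - ψ (probIntegralTransform (κ z) t)| ≤ L * c := by
  have hlip (u v : I) (huv : |(u : ℝ) - v| ≤ c) : |ψ u - ψ v| ≤ L * c := by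
    have := hψ.dist_le_mul u v
    rw [Real.dist_eq, Subtype.dist_eq, Real.dist_eq] at this
    exact this.trans (by gcongr)
  have hLc : 0 ≤ L * c := by positivity
  obtain ⟨a, ha, hFa, hmina⟩ := exists_condQuantile_eq hκ hτ₀ z
  obtain ⟨b, hb, hFb, hminb⟩ := exists_condQuantile_eq hκ hτ₁ z
  have hab := condQuantile_mono_level hκ h₀₁ hτ₀ hτ₁ z
  have hGa : |condDF κ a z - G a z| ≤ c :=
    abs_le_of_supNormOn_le hc h ⟨ha.ge, by rw [ha]; exact hab⟩
  have hGb : |condDF κ b z - G b z| ≤ c :=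
    abs_le_of_supNormOn_le hc h ⟨by rw [hb]; exact hab, hb.le⟩
  rw [hFa, abs_le] at hGa
  rw [hFb, abs_le] at hGb
  have hF : (probIntegralTransform (κ z) t : ℝ) = condDF κ t z := rfl
  -- Left of the range `F(t) < τ₀`, so both `ψ(F(t))` and `ψ(τ₀)` vanish. Either `G(t) ≤ τ₀` and
  -- there is no error, or monotonicity traps `τ₀ ≤ G(t) ≤ G(a) ≤ τ₀ + c`. The right side is
  -- symmetric, with `b` and `τ₁`.
  rcases lt_or_ge t a with hta | hta
  · have hFt : condDF κ t z < τ₀ := lt_of_not_ge fun h' => absurd (hmina t h') (not_le.2 hta)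
    rw [hlo _ (hF.le.trans hFt.le), ← hlo ⟨τ₀, hτ₀⟩ le_rfl]
    rcases le_total (G t z : ℝ) τ₀ with hG' | hG'
    · rw [hlo _ hG', hlo ⟨τ₀, hτ₀⟩ le_rfl]
      simpa using hLc
    · refine hlip _ _ ?_
      have : (G t z : ℝ) ≤ G a z := hG z hta.le
      rw [abs_le]
      constructor <;> simp only <;> linarith
  rcases lt_or_ge b t with htb | htb
  · have hFt : τ₁ ≤ condDF κ t z := hFb.ge.trans (monotone_measureReal_Iic (κ z) htb.le)
    rw [hhi _ (hFt.trans hF.ge), ← hhi ⟨τ₁, hτ₁⟩ le_rfl]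
    rcases le_total τ₁ (G t z : ℝ) with hG' | hG'
    · rw [hhi _ hG', hhi ⟨τ₁, hτ₁⟩ le_rfl]
      simpa using hLc
    · refine hlip _ _ ?_
      have : (G b z : ℝ) ≤ G t z := hG z htb.le
      rw [abs_le]
      constructor <;> simp only <;> linarith
  · refine hlip _ _ ?_
    rw [abs_sub_comm, hF]
    exact abs_le_of_supNormOn_le (f := fun t z => condDF κ t z - G t z) hc h ⟨ha ▸ hta, hb ▸ htb⟩

end DistributionFunctions

/-! ### The central limit theorem and the `χ²` distribution. -/

section LimitTheorems

open scoped RealInnerProductSpace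

section CLT

variable {Ω : Type*} [MeasurableSpace Ω] {E : Type*} [NormedAddCommGroup E]
  [InnerProductSpace ℝ E] [FiniteDimensional ℝ E] [MeasurableSpace E] [BorelSpace E]

/-- The normalized sum `n^(-1/2) ∑ᵢ V(ωᵢ)`. -/
def normalizedSum (V : Ω → E) (n : ℕ) (ω : Fin n → Ω) : E :=
  (√(n : ℝ))⁻¹ • ∑ i, V (ω i)

lemma measurable_normalizedSum {V : Ω → E} (hV : Measurable V) (n : ℕ) :
    Measurable (normalizedSum V n) := by
  unfold normalizedSum
  fun_prop

lemma charFun_map_normalizedSum (μ : Measure Ω) [IsProbabilityMeasure μ] {V : Ω → E}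
    (hV : Measurable V) (n : ℕ) (t : E) :
    charFun ((Measure.pi fun _ : Fin n => μ).map (normalizedSum V n)) t =
      charFun (μ.map V) ((√(n : ℝ))⁻¹ • t) ^ n := by
  rw [charFun_apply, integral_map (measurable_normalizedSum hV n).aemeasurable
    (by fun_prop), charFun_apply, integral_map hV.aemeasurable (by fun_prop)]
  have : ∀ ω : Fin n → Ω, Complex.exp (⟪normalizedSum V n ω, t⟫ * Complex.I) =
      ∏ i, Complex.exp (⟪V (ω i), (√(n : ℝ))⁻¹ • t⟫ * Complex.I) := by
    intro ω
    rw [← Complex.exp_sum, ← Finset.sum_mul, normalizedSum, real_inner_smul_left, sum_inner]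
    simp [real_inner_smul_right, Finset.mul_sum]
  simp_rw [this]
  rw [integral_fintype_prod_eq_prod (fun (_ : Fin n) x =>
    Complex.exp (⟪V x, (√(n : ℝ))⁻¹ • t⟫ * Complex.I))]
  simp

/-- Multivariate central limit theorem for standardized random vectors. -/
lemma tendsto_charFun_normalizedSum (μ : Measure Ω) [IsProbabilityMeasure μ] {V : Ω → E}
    (hV : Measurable V) (h0 : ∀ t, ∫ x, ⟪V x, t⟫ ∂μ = 0)
    (h1 : ∀ t, ∫ x, ⟪V x, t⟫ ^ 2 ∂μ = ‖t‖ ^ 2) (t : E) :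
    Tendsto (fun n => charFun ((Measure.pi fun _ : Fin n => μ).map (normalizedSum V n)) t)
      atTop (𝓝 (charFun (stdGaussian E) t)) := by
  simp_rw [charFun_map_normalizedSum μ hV, charFun_stdGaussian]
  rcases eq_or_ne t 0 with rfl | ht
  · have : IsProbabilityMeasure (μ.map V) := Measure.isProbabilityMeasure_map hV.aemeasurable
    simp
  have hn : ‖t‖ ≠ 0 := norm_ne_zero_iff.2 ht
  -- Reduction to dimension one in the Cramér–Wold manner: project onto the unit direction `e` of
  -- `t` and evaluate the real characteristic function at `‖t‖`.
  set e : E := ‖t‖⁻¹ • t with he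
  have hte : t = ‖t‖ • e := by rw [he, smul_smul, mul_inv_cancel₀ hn, one_smul]
  have hen : ‖e‖ = 1 := by rw [he, norm_smul, norm_inv, norm_norm, inv_mul_cancel₀ hn]
  have hX : Measurable fun x => ⟪V x, e⟫ := by fun_prop
  have key := tendsto_charFun_inv_sqrt_mul_pow (P := μ) (X := fun x => ⟪V x, e⟫) hX.aemeasurable
    (h0 e) (by simpa [hen] using h1 e) ‖t‖
  convert key using 3 with n
  rw [charFun_apply, charFun_apply_real, integral_map hV.aemeasurable (by fun_prop),
    integral_map hX.aemeasurable (by fun_prop)]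
  congr 1
  ext x
  congr 2
  rw [real_inner_smul_right]
  conv_lhs => rw [hte, real_inner_smul_right]
  push_cast
  ring

end CLT

section ChiSq

/-- Fubini: once all coordinates but one are fixed, the remaining one can take at most the two
values `±√(c - ∑ yᵢ²)`. -/
lemma pi_gaussianReal_sum_sq_eq_null (m : ℕ) (hm : m ≠ 0) (c : ℝ) :
    (Measure.pi fun _ : Fin m => gaussianReal 0 1) {x | ∑ i, x i ^ 2 = c} = 0 := by
  obtain ⟨m, rfl⟩ := Nat.exists_eq_succ_of_ne_zero hm
  have hmp := measurePreserving_piFinSuccAbove (fun _ : Fin (m + 1) => gaussianReal 0 1) 0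
  have hms : MeasurableSet {p : ℝ × (Fin m → ℝ) | p.1 ^ 2 + ∑ i, p.2 i ^ 2 = c} :=
    measurableSet_eq_fun (by fun_prop) (by fun_prop)
  have hpre : {x : Fin (m + 1) → ℝ | ∑ i, x i ^ 2 = c} =
      (MeasurableEquiv.piFinSuccAbove (fun _ => ℝ) 0) ⁻¹'
        {p : ℝ × (Fin m → ℝ) | p.1 ^ 2 + ∑ i, p.2 i ^ 2 = c} := by
    ext x
    simp [Fin.sum_univ_succ, MeasurableEquiv.piFinSuccAbove, Fin.insertNthEquiv, Fin.tail]
  rw [hpre, hmp.measure_preimage hms.nullMeasurableSet]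
  have hsw := Measure.measure_prod_null (μ := Measure.pi fun _ : Fin m => gaussianReal 0 1)
    (ν := gaussianReal 0 1) (hms.preimage measurable_swap)
  rw [← Measure.prod_swap, Measure.map_apply measurable_swap hms, hsw]
  refine .of_forall fun y => ?_
  have := nullSingletonClass_gaussianReal (μ := 0) (v := 1) one_ne_zero
  refine Set.Finite.measure_zero (Set.Finite.subset (s := {√(c - ∑ i, y i ^ 2),
    -√(c - ∑ i, y i ^ 2)}) (by simp) ?_) _
  intro x hx
  have hx' : x ^ 2 = c - ∑ i, y i ^ 2 := by
    have : x ^ 2 + ∑ i, y i ^ 2 = c := hx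
    linarith
  rw [← hx', Real.sqrt_sq_eq_abs]
  rcases abs_choice x with h | h <;> simp [h]

instance isProbabilityMeasure_chiSq (m : ℕ) : IsProbabilityMeasure (chiSq m) :=
  Measure.isProbabilityMeasure_map (Measurable.aemeasurable (by fun_prop))

lemma chiSq_singleton {m : ℕ} (hm : m ≠ 0) (c : ℝ) : chiSq m {c} = 0 := by
  rw [chiSq, Measure.map_apply (by fun_prop) (measurableSet_singleton c)]
  exact pi_gaussianReal_sum_sq_eq_null m hm c

lemma chiSq_eq_map_stdGaussian {ι : Type*} [Fintype ι] {m : ℕ} (hm : Fintype.card ι = m) :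
    chiSq m = (stdGaussian (EuclideanSpace ℝ ι)).map fun x => ‖x‖ ^ 2 := by
  let b := (EuclideanSpace.basisFun ι ℝ).reindex (Fintype.equivFinOfCardEq hm)
  rw [stdGaussian_eq_map_pi_orthonormalBasis b, Measure.map_map (by fun_prop) (by fun_prop), chiSq]
  congr 1
  ext x
  simp only [Function.comp_apply]
  rw [← real_inner_self_eq_norm_sq, b.orthonormal.inner_sum]
  simp [sq]

lemma quantile_chiSq_nonneg (m : ℕ) {p : ℝ} (hp : 0 < p) : 0 ≤ quantile (chiSq m) p := by
  refine Real.sInf_nonneg fun x hx => ?_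
  by_contra! hneg
  have : chiSq m (Set.Iic x) = 0 := by
    rw [chiSq, Measure.map_apply (by fun_prop) measurableSet_Iic]
    refine measure_mono_null (fun y hy => ?_) measure_empty
    exact absurd (hneg.trans_le (by positivity)) (not_lt.2 hy)
  have hx' : p ≤ cdf (chiSq m) x := hx
  rw [cdf_eq_real, measureReal_def, this] at hx'
  simp at hx'
  linarith

end ChiSq

end LimitTheorems

/-! ### Independence of residuals, and Chebyshev's inequality for the cross terms. -/

section ResidualIndependence

section Independence

variable {d : ℕ}

/-- The transform `F(t | z)` as a function with values in the unit interval. -/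
def condPIT (κ : Kernel (Fin d → I) I) [IsMarkovKernel κ] (t : I) (z : Fin d → I) : I :=
  probIntegralTransform (κ z) t

lemma measurable_condPIT (κ : Kernel (Fin d → I) I) [IsMarkovKernel κ] :
    Measurable fun p : I × (Fin d → I) => condPIT κ p.1 p.2 := by
  refine Measurable.subtype_mk ?_
  have hms : MeasurableSet {p : (I × (Fin d → I)) × I | p.2 ≤ p.1.1} :=
    measurableSet_le measurable_snd (measurable_fst.comp measurable_fst)
  have := Kernel.measurable_kernel_prodMk_left (κ := κ.prodMkLeft I) hms
  exact this.ennreal_toReal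

/-- If `V` and `W` are conditionally independent given `Z`, then the residual `F(V | Z)` is
uniformly distributed and independent of `(W, Z)`. -/
lemma map_condPIT_eq_prod {P : ProbabilityMeasure (Obs d)} {V W : Obs d → I} (hV : Measurable V)
    (hW : Measurable W) {κ : Kernel (Fin d → I) I} [IsMarkovKernel κ]
    (hκ : IsContCondDistrib P V κ)
    (hind : CondIndepFun (MeasurableSpace.comap (obsZ : Obs d → Fin d → I) inferInstance)
      measurable_obsZ.comap_le W V (P : Measure (Obs d))) :
    (P : Measure (Obs d)).map (fun w => (condPIT κ (V w) (obsZ w), (W w, obsZ w))) =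
      (volume : Measure I).prod ((P : Measure (Obs d)).map fun w => (W w, obsZ w)) := by
  have hZ := measurable_obsZ (d := d)
  set μ : Measure (Obs d) := (P : Measure (Obs d))
  have hF := measurable_condPIT κ
  -- Conditional independence says that the law of `V` given `(Z, W)` depends on `Z` alone; it is
  -- then almost everywhere `κ`.
  have h1 := (condIndepFun_iff_condDistrib_prod_ae_eq_prodMkRight hV hW hZ).1 hind
  have h2 : condDistrib V obsZ μ =ᵐ[μ.map obsZ] κ :=
    condDistrib_ae_eq_of_measure_eq_compProd _ hV.aemeasurable hκ.condDistrib.map_eq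
  have h3 : ∀ᵐ p ∂(μ.map fun w => (obsZ w, W w)), condDistrib V obsZ μ p.1 = κ p.1 := by
    have : μ.map obsZ = (μ.map fun w => (obsZ w, W w)).map Prod.fst := by
      rw [Measure.map_map measurable_fst (by fun_prop)]
      rfl
    rw [this] at h2
    exact ae_of_ae_map measurable_fst.aemeasurable h2
  have h4 : condDistrib V (fun w => (obsZ w, W w)) μ =ᵐ[μ.map fun w => (obsZ w, W w)]
      κ.prodMkRight I := by
    filter_upwards [h1, h3] with p hp hp'
    rw [hp, Kernel.prodMkRight_apply, Kernel.prodMkRight_apply, hp']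
  have h5 := (condDistrib_ae_eq_iff_measure_eq_compProd (fun w => (obsZ w, W w))
    hV.aemeasurable (κ.prodMkRight I)).1 h4
  have hg : Measurable fun r : ((Fin d → I) × I) × I => (condPIT κ r.2 r.1.1, (r.1.2, r.1.1)) :=
    (hF.comp (by fun_prop : Measurable fun r : ((Fin d → I) × I) × I => (r.2, r.1.1))).prodMk
      (by fun_prop)
  have h6 : μ.map (fun w => (condPIT κ (V w) (obsZ w), (W w, obsZ w))) =
      (μ.map fun w => ((obsZ w, W w), V w)).map
        fun r => (condPIT κ r.2 r.1.1, (r.1.2, r.1.1)) := by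
    rw [Measure.map_map hg (by fun_prop)]
    rfl
  rw [h6, h5]
  symm
  refine Measure.prod_eq fun s t hs ht => ?_
  rw [Measure.map_apply hg (hs.prod ht), Measure.compProd_apply (hg (hs.prod ht)),
    Measure.map_apply (by fun_prop) ht]
  have hB : MeasurableSet ((fun p : (Fin d → I) × I => (p.2, p.1)) ⁻¹' t) :=
    measurable_swap ht
  -- For each `z` the transform carries `κ z` to Lebesgue measure, so the fibre mass `volume s` does
  -- not depend on `(z, w)`. This is the product structure.
  have h7 : ∀ p : (Fin d → I) × I, κ.prodMkRight I p (Prod.mk p ⁻¹'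
      ((fun r : ((Fin d → I) × I) × I => (condPIT κ r.2 r.1.1, (r.1.2, r.1.1))) ⁻¹' (s ×ˢ t))) =
      ((fun p : (Fin d → I) × I => (p.2, p.1)) ⁻¹' t).indicator (fun _ => volume s) p := by
    intro p
    by_cases hp : (p.2, p.1) ∈ t
    · rw [Set.indicator_of_mem (by exact hp), Kernel.prodMkRight_apply,
        ← map_probIntegralTransform (κ p.1) (hκ.continuous p.1),
        Measure.map_apply (continuous_probIntegralTransform _ (hκ.continuous p.1)).measurable hs]
      congr 1
      ext x
      simp [condPIT, hp]
    · rw [Set.indicator_of_notMem (by exact hp)]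
      refine measure_mono_null (fun x hx => ?_) measure_empty
      exact hp hx.2
  simp_rw [h7]
  rw [lintegral_indicator hB, setLIntegral_const, Measure.map_apply (by fun_prop) hB]
  rfl

end Independence

section Chebyshev

variable {Ω 𝓤 𝓦 : Type*} [MeasurableSpace Ω] [MeasurableSpace 𝓤] [MeasurableSpace 𝓦]

/-- Off-diagonal terms vanish by independence and centering; the diagonal ones give `bᵢ²`. -/
lemma integral_sq_sum_mul_pi (ν : Measure 𝓤) [IsProbabilityMeasure ν] {ψ : 𝓤 → ℝ}
    (hψ : Measurable ψ) {K : ℝ} (hK : ∀ u, |ψ u| ≤ K) (h0 : ∫ u, ψ u ∂ν = 0)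
    (h1 : ∫ u, ψ u ^ 2 ∂ν = 1) {n : ℕ} (b : Fin n → ℝ) :
    ∫ u, (∑ i, ψ (u i) * b i) ^ 2 ∂(Measure.pi fun _ : Fin n => ν) = ∑ i, b i ^ 2 := by
  have hint (i j : Fin n) : Integrable (fun u : Fin n → 𝓤 => (ψ (u i) * b i) * (ψ (u j) * b j))
      (Measure.pi fun _ : Fin n => ν) := by
    refine Integrable.of_bound (Measurable.aestronglyMeasurable (by fun_prop))
      ((K * |b i|) * (K * |b j|)) (.of_forall fun u => ?_)
    have hK0 : 0 ≤ K := (abs_nonneg _).trans (hK (u i))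
    rw [Real.norm_eq_abs, abs_mul, abs_mul, abs_mul]
    gcongr
    · exact hK _
    · exact hK _
  have hij (i j : Fin n) :
      ∫ u, (ψ (u i) * b i) * (ψ (u j) * b j) ∂(Measure.pi fun _ : Fin n => ν) =
        if i = j then b i ^ 2 else 0 := by
    split_ifs with h
    · subst h
      have : ∀ u : Fin n → 𝓤, (ψ (u i) * b i) * (ψ (u i) * b i) = b i ^ 2 * ψ (u i) ^ 2 :=
        fun u => by ring
      simp_rw [this]
      rw [integral_const_mul, integral_comp_eval (μ := fun _ : Fin n => ν)
        (f := fun x => ψ x ^ 2) (hψ.pow_const 2).aestronglyMeasurable, h1, mul_one]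
    · have hind : IndepFun (fun u : Fin n → 𝓤 => ψ (u i)) (fun u => ψ (u j))
          (Measure.pi fun _ : Fin n => ν) :=
        (iIndepFun_pi (μ := fun _ : Fin n => ν) (X := fun _ => ψ)
          (fun _ => hψ.aemeasurable)).indepFun h
      have : ∀ u : Fin n → 𝓤, (ψ (u i) * b i) * (ψ (u j) * b j) =
          (b i * b j) * (ψ (u i) * ψ (u j)) := fun u => by ring
      simp_rw [this]
      rw [integral_const_mul, hind.integral_fun_mul_eq_mul_integral
        (Measurable.aestronglyMeasurable (by fun_prop))
        (Measurable.aestronglyMeasurable (by fun_prop)),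
        integral_comp_eval (μ := fun _ : Fin n => ν) hψ.aestronglyMeasurable, h0, zero_mul,
        mul_zero]
  simp_rw [sq, Finset.sum_mul_sum]
  rw [integral_finsetSum _ fun i _ => integrable_finsetSum _ fun j _ => hint i j]
  simp_rw [integral_finsetSum _ fun j _ => hint _ j, hij]
  simp [sq]

/-- If `U` has law `ν` and is independent of `W`, then the cross term `n^(-1/2) ∑ᵢ ψ(Uᵢ) bᵢ`, with
bounded weights computed from `(Wᵢ)ᵢ`, satisfies Chebyshev's inequality. -/
lemma measure_pi_lt_abs_sum_mul_le {P : Measure Ω} [IsProbabilityMeasure P] {ν : Measure 𝓤}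
    [IsProbabilityMeasure ν] {U : Ω → 𝓤} {W : Ω → 𝓦} (hU : Measurable U) (hW : Measurable W)
    (hUW : P.map (fun w => (U w, W w)) = ν.prod (P.map W)) {ψ : 𝓤 → ℝ} (hψ : Measurable ψ)
    {K : ℝ} (hK : ∀ u, |ψ u| ≤ K) (h0 : ∫ u, ψ u ∂ν = 0) (h1 : ∫ u, ψ u ^ 2 ∂ν = 1) {n : ℕ}
    {b : (Fin n → 𝓦) → Fin n → ℝ} (hb : ∀ i, Measurable fun x => b x i) {B : ℝ}
    (hbB : ∀ x i, |b x i| ≤ B) {ε : ℝ} (hε : 0 < ε) :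
    (Measure.pi fun _ : Fin n => P)
      {s | ε < |(√(n : ℝ))⁻¹ * ∑ i, ψ (U (s i)) * b (fun i => W (s i)) i|} ≤
      ENNReal.ofReal (B ^ 2 / ε ^ 2) := by
  rcases Nat.eq_zero_or_pos n with rfl | hn
  · simp [hε.not_gt]
  have : IsProbabilityMeasure (P.map W) := Measure.isProbabilityMeasure_map hW.aemeasurable
  set ρ := (Measure.pi fun _ : Fin n => ν).prod (Measure.pi fun _ : Fin n => P.map W)
  -- A sample of independent pairs is regrouped into two independent samples, so that the `U` sample
  -- can be integrated first with the weights held fixed.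
  have hmap : (Measure.pi fun _ : Fin n => P).map
      (fun s => ((fun i => U (s i)), fun i => W (s i))) = ρ := by
    have hmp := measurePreserving_arrowProdEquivProdArrow 𝓤 𝓦 (Fin n) (fun _ => ν)
      (fun _ => P.map W)
    change _ = (Measure.pi fun _ : Fin n => ν).prod (Measure.pi fun _ : Fin n => P.map W)
    rw [← hmp.map_eq, ← hUW, ← Measure.pi_map_pi (fun _ => (by fun_prop)),
      Measure.map_map (MeasurableEquiv.measurable _) (by fun_prop)]
    rfl
  let f : (Fin n → 𝓤) × (Fin n → 𝓦) → ℝ := fun p => (√(n : ℝ))⁻¹ * ∑ i, ψ (p.1 i) * b p.2 i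
  have hf : Measurable f := by
    have hb' : ∀ i, Measurable fun p : (Fin n → 𝓤) × (Fin n → 𝓦) => b p.2 i :=
      fun i => (hb i).comp measurable_snd
    fun_prop
  have hpre : (Measure.pi fun _ : Fin n => P)
      {s | ε < |(√(n : ℝ))⁻¹ * ∑ i, ψ (U (s i)) * b (fun i => W (s i)) i|} =
      ρ {p | ε < |f p|} := by
    rw [← hmap, Measure.map_apply (by fun_prop) (measurableSet_lt measurable_const hf.abs)]
    rfl
  have hbd : ∀ p, |f p| ≤ (√(n : ℝ))⁻¹ * ∑ _i : Fin n, K * B := by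
    intro p
    rw [abs_mul, abs_of_nonneg (by positivity : 0 ≤ (√(n : ℝ))⁻¹)]
    gcongr
    refine (Finset.abs_sum_le_sum_abs _ _).trans (Finset.sum_le_sum fun i _ => ?_)
    rw [abs_mul]
    exact mul_le_mul (hK _) (hbB _ _) (abs_nonneg _) ((abs_nonneg _).trans (hK (p.1 i)))
  have hint : Integrable (fun p => f p ^ 2) ρ := by
    refine Integrable.of_bound (hf.pow_const 2).aestronglyMeasurable
      (((√(n : ℝ))⁻¹ * ∑ _i : Fin n, K * B) ^ 2) (.of_forall fun p => ?_)
    rw [Real.norm_eq_abs, abs_pow]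
    gcongr
    exact hbd p
  have hsecond : ∫ p, f p ^ 2 ∂ρ ≤ B ^ 2 := by
    rw [integral_prod_symm _ hint]
    have hin (y : Fin n → 𝓦) : ∫ x, f (x, y) ^ 2 ∂(Measure.pi fun _ : Fin n => ν) ≤ B ^ 2 := by
      simp only [f, mul_pow]
      rw [integral_const_mul, integral_sq_sum_mul_pi ν hψ hK h0 h1, inv_pow,
        Real.sq_sqrt (by positivity), inv_mul_le_iff₀ (by positivity)]
      calc ∑ i, b y i ^ 2 ≤ ∑ _i : Fin n, B ^ 2 := Finset.sum_le_sum fun i _ => by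
            rw [← sq_abs (b y i)]
            gcongr
            exact hbB y i
        _ = n * B ^ 2 := by simp
    calc ∫ y, ∫ x, f (x, y) ^ 2 ∂(Measure.pi fun _ : Fin n => ν)
          ∂(Measure.pi fun _ : Fin n => P.map W)
        ≤ ∫ _y, B ^ 2 ∂(Measure.pi fun _ : Fin n => P.map W) :=
          integral_mono hint.integral_prod_right (integrable_const _) hin
      _ = B ^ 2 := by simp
  rw [hpre]
  have hmarkov := mul_meas_ge_le_integral_of_nonneg (μ := ρ) (f := fun p => f p ^ 2)
    (.of_forall fun p => sq_nonneg _) hint (ε ^ 2)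
  have hsub : ρ {p | ε < |f p|} ≤ ρ {p | ε ^ 2 ≤ f p ^ 2} := by
    refine measure_mono fun p hp => ?_
    have hp' : ε < |f p| := hp
    change ε ^ 2 ≤ f p ^ 2
    rw [← sq_abs (f p)]
    gcongr
  refine hsub.trans ?_
  rw [← ofReal_measureReal]
  refine ENNReal.ofReal_le_ofReal ?_
  rw [le_div_iff₀ (by positivity), mul_comm]
  exact hmarkov.trans hsecond

end Chebyshev

end ResidualIndependence

/-! ### Orthonormalization of the score functions. -/

section Scores

open scoped Matrix

instance isOpenPosMeasure_volume_unitInterval : (volume : Measure I).IsOpenPosMeasure where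
  open_pos U hU hne := by
    obtain ⟨a, b, hab, hsub⟩ := hU.exists_Ioo_subset hne
    have : (volume : Measure I) (Set.Ioo a b) ≠ 0 := by
      rw [unitInterval.volume_Ioo]
      simpa using hab
    exact fun h => this (measure_mono_null hsub h)

/-- Lipschitz score functions vanishing off `(τ₀, τ₁)` which are centered and orthonormal. -/
structure IsOrthonormalScore {q : ℕ} (ψ : Fin q → I → ℝ) (τ₀ τ₁ : ℝ) : Prop where
  lipschitz : ∃ L : ℝ≥0, ∀ k, LipschitzWith L (ψ k)
  integral_eq_zero : ∀ k, ∫ u, ψ k u = 0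
  integral_mul : ∀ k l, ∫ u, ψ k u * ψ l u = if k = l then 1 else 0
  eq_zero_of_le : ∀ k (u : I), (u : ℝ) ≤ τ₀ → ψ k u = 0
  eq_zero_of_ge : ∀ k (u : I), τ₁ ≤ u → ψ k u = 0

namespace IsOrthonormalScore

variable {q : ℕ} {ψ : Fin q → I → ℝ} {τ₀ τ₁ : ℝ}

lemma continuous (hψ : IsOrthonormalScore ψ τ₀ τ₁) (k : Fin q) : Continuous (ψ k) := by
  obtain ⟨L, hL⟩ := hψ.lipschitz
  exact (hL k).continuous

lemma measurable (hψ : IsOrthonormalScore ψ τ₀ τ₁) (k : Fin q) : Measurable (ψ k) :=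
  (hψ.continuous k).measurable

lemma integral_sq (hψ : IsOrthonormalScore ψ τ₀ τ₁) (k : Fin q) : ∫ u, ψ k u ^ 2 = 1 := by
  simpa [sq] using hψ.integral_mul k k

lemma exists_abs_le (hψ : IsOrthonormalScore ψ τ₀ τ₁) : ∃ K, ∀ k u, |ψ k u| ≤ K := by
  have h (k : Fin q) : ∃ K, ∀ u, |ψ k u| ≤ K := by
    obtain ⟨K, hK⟩ := isCompact_univ.exists_bound_of_continuousOn (hψ.continuous k).continuousOn
    exact ⟨K, fun u => hK u trivial⟩
  choose K hK using h
  refine ⟨∑ k, |K k|, fun k u => (hK k u).trans ((le_abs_self _).trans ?_)⟩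
  exact Finset.single_le_sum (f := fun k => |K k|) (fun _ _ => abs_nonneg _) (Finset.mem_univ k)

end IsOrthonormalScore

section Standardization

variable {q : ℕ} {φ : Fin q → I → ℝ}

lemma IsScoreMap.continuous (hφ : IsScoreMap φ) (k : Fin q) : Continuous (φ k) := by
  obtain ⟨L, hL⟩ := hφ.lipschitz k
  exact hL.continuous

lemma integrable_unitInterval_of_continuous {f : I → ℝ} (hf : Continuous f) :
    Integrable f (volume : Measure I) :=
  hf.integrable_of_hasCompactSupport (HasCompactSupport.of_compactSpace f)

lemma dotProduct_covMatrix_mulVec (hφ : IsScoreMap φ) (x y : Fin q → ℝ) :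
    x ⬝ᵥ (covMatrix φ).mulVec y = ∫ u, (∑ k, x k * φ k u) * (∑ l, y l * φ l u) := by
  have hi (k l : Fin q) : Integrable (fun u => x k * φ k u * (y l * φ l u)) :=
    integrable_unitInterval_of_continuous
      ((continuous_const.mul (hφ.continuous k)).mul (continuous_const.mul (hφ.continuous l)))
  simp_rw [Finset.sum_mul_sum]
  rw [integral_finsetSum _ fun k _ => integrable_finsetSum _ fun l _ => hi k l]
  simp_rw [integral_finsetSum _ fun l _ => hi _ l]
  simp only [dotProduct, Matrix.mulVec, covMatrix, Matrix.of_apply, Finset.mul_sum]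
  refine Finset.sum_congr rfl fun k _ => Finset.sum_congr rfl fun l _ => ?_
  rw [mul_comm (∫ u, φ k u * φ l u), ← integral_const_mul, ← integral_const_mul]
  congr 1
  ext u
  ring

lemma covMatrix_isHermitian (φ : Fin q → I → ℝ) : (covMatrix φ).IsHermitian := by
  ext k l
  simp [covMatrix, mul_comm]

/-- The quadratic form at `x` is `∫ (∑ x_k φ_k)²`. A nontrivial combination is nonzero at some
point, hence by continuity on an open set of positive measure. -/
lemma covMatrix_posDef (hφ : IsScoreMap φ) : (covMatrix φ).PosDef := by
  refine Matrix.PosDef.of_dotProduct_mulVec_pos (covMatrix_isHermitian φ) fun x hx => ?_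
  rw [star_trivial, dotProduct_covMatrix_mulVec hφ]
  have hc : Continuous fun u => ∑ k, x k * φ k u :=
    continuous_finsetSum _ fun k _ => continuous_const.mul (hφ.continuous k)
  have hne : ∃ u, ∑ k, x k * φ k u ≠ 0 := by
    by_contra! h
    refine hx (funext fun k => ?_)
    refine Fintype.linearIndependent_iff.1 hφ.linearIndependent x (funext fun u => ?_) k
    simpa using h u
  obtain ⟨u, hu⟩ := hne
  exact (hc.mul hc).integral_pos_of_hasCompactSupport_nonneg_nonzero (x := u)
    (HasCompactSupport.of_compactSpace _) (fun u => mul_self_nonneg _) (mul_ne_zero hu hu)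

open scoped MatrixOrder in
lemma covMatrixInvSqrt_isSymm (φ : Fin q → I → ℝ) (k l : Fin q) :
    covMatrixInvSqrt φ k l = covMatrixInvSqrt φ l k := by
  have h : (covMatrixInvSqrt φ).IsHermitian :=
    (Matrix.nonneg_iff_posSemidef.1 (CFC.sqrt_nonneg (covMatrix φ))).isHermitian.inv
  simpa using (h.apply k l).symm

open scoped MatrixOrder in
lemma covMatrixInvSqrt_mul_covMatrix_mul (hφ : IsScoreMap φ) :
    covMatrixInvSqrt φ * covMatrix φ * covMatrixInvSqrt φ = 1 := by
  have hpd := covMatrix_posDef hφ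
  have hsq : CFC.sqrt (covMatrix φ) * CFC.sqrt (covMatrix φ) = covMatrix φ :=
    CFC.sqrt_mul_sqrt_self _ hpd.posSemidef.nonneg
  have hdet : IsUnit (CFC.sqrt (covMatrix φ)).det := by
    have h1 : (CFC.sqrt (covMatrix φ)).det * (CFC.sqrt (covMatrix φ)).det ≠ 0 := by
      rw [← Matrix.det_mul, hsq]
      exact hpd.det_pos.ne'
    exact isUnit_iff_ne_zero.2 (left_ne_zero_of_mul h1)
  unfold covMatrixInvSqrt
  generalize CFC.sqrt (covMatrix φ) = S at hsq hdet
  rw [← hsq, ← mul_assoc, Matrix.nonsing_inv_mul _ hdet, one_mul, Matrix.mul_nonsing_inv _ hdet]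

/-- The standardized score functions `Σ^(-1/2) φ`. -/
def standardScore (φ : Fin q → I → ℝ) (k : Fin q) (u : I) : ℝ :=
  ∑ j, covMatrixInvSqrt φ k j * φ j u

lemma eq_zero_of_le_tauMin (hφ : IsScoreMap φ) (k : Fin q) {u : I} (hu : (u : ℝ) ≤ tauMin φ) :
    φ k u = 0 := by
  have hbdd : BddBelow (supportUnion φ) := ⟨0, by rintro _ ⟨v, -, rfl⟩; exact v.2.1⟩
  have hlt : ∀ v : I, v < u → φ k v = 0 := fun v hv => by
    refine image_eq_zero_of_notMem_tsupport fun hmem => ?_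
    exact absurd (csInf_le hbdd ⟨v, Set.mem_iUnion.2 ⟨k, hmem⟩, rfl⟩)
      (not_le.2 (lt_of_lt_of_le hv hu))
  -- The value at `u = τmin` itself follows by continuity from the points below it. At `u = 0` there
  -- are none, and the inclusion of the support in `(0, 1)` is used instead.
  rcases eq_or_ne u 0 with rfl | h0
  · refine image_eq_zero_of_notMem_tsupport fun hmem => ?_
    exact lt_irrefl _ (hφ.support k hmem).1
  · have hcl : IsClosed {v | φ k v = 0} := isClosed_eq (hφ.continuous k) continuous_const
    have hne : (Set.Iio u).Nonempty := ⟨0, unitInterval.pos_iff_ne_zero.2 h0⟩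
    have hu' : u ∈ closure (Set.Iio u) := by
      rw [closure_Iio' hne]
      simp
    exact hcl.closure_subset_iff.2 (fun v hv => hlt v hv) hu'

lemma eq_zero_of_tauMax_le (hφ : IsScoreMap φ) (k : Fin q) {u : I} (hu : tauMax φ ≤ u) :
    φ k u = 0 := by
  have hbdd : BddAbove (supportUnion φ) := ⟨1, by rintro _ ⟨v, -, rfl⟩; exact v.2.2⟩
  have hlt : ∀ v : I, u < v → φ k v = 0 := fun v hv => by
    refine image_eq_zero_of_notMem_tsupport fun hmem => ?_
    exact absurd (le_csSup hbdd ⟨v, Set.mem_iUnion.2 ⟨k, hmem⟩, rfl⟩)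
      (not_le.2 (lt_of_le_of_lt hu hv))
  rcases eq_or_ne u 1 with rfl | h0
  · refine image_eq_zero_of_notMem_tsupport fun hmem => ?_
    exact lt_irrefl _ (hφ.support k hmem).2
  · have hcl : IsClosed {v | φ k v = 0} := isClosed_eq (hφ.continuous k) continuous_const
    have hne : (Set.Ioi u).Nonempty := ⟨1, unitInterval.lt_one_iff_ne_one.2 h0⟩
    have hu' : u ∈ closure (Set.Ioi u) := by
      rw [closure_Ioi' hne]
      simp
    exact hcl.closure_subset_iff.2 (fun v hv => hlt v hv) hu'

/-- The union of the supports is nonempty because `∫ φ₁² = 1`; otherwise the infimum and supremum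
would be default values. -/
lemma tau_bounds (hq : 1 ≤ q) (hφ : IsScoreMap φ) :
    tauMin φ ≤ tauMax φ ∧ tauMin φ ∈ I ∧ tauMax φ ∈ I := by
  have hlo : (0 : ℝ) ∈ lowerBounds (supportUnion φ) := by rintro _ ⟨v, -, rfl⟩; exact v.2.1
  have hhi : (1 : ℝ) ∈ upperBounds (supportUnion φ) := by rintro _ ⟨v, -, rfl⟩; exact v.2.2
  obtain ⟨x, hx⟩ : (supportUnion φ).Nonempty := by
    by_contra h
    have h0 : ∀ u, φ ⟨0, hq⟩ u = 0 := fun u =>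
      image_eq_zero_of_notMem_tsupport fun hmem =>
        h ⟨_, u, Set.mem_iUnion.2 ⟨_, hmem⟩, rfl⟩
    have := hφ.integral_sq_eq_one ⟨0, hq⟩
    simp [h0] at this
  have h1 : tauMin φ ≤ x := csInf_le ⟨0, hlo⟩ hx
  have h2 : x ≤ tauMax φ := le_csSup ⟨1, hhi⟩ hx
  exact ⟨h1.trans h2, ⟨le_csInf ⟨x, hx⟩ hlo, h1.trans (hhi hx)⟩,
    ⟨(hlo hx).trans h2, csSup_le ⟨x, hx⟩ hhi⟩⟩

/-- The Gram matrix of `Σ^(-1/2) φ` is `Σ^(-1/2) Σ Σ^(-1/2) = 1`. -/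
lemma isOrthonormalScore_standardScore (hφ : IsScoreMap φ) :
    IsOrthonormalScore (standardScore φ) (tauMin φ) (tauMax φ) where
  lipschitz := by
    choose L hL using hφ.lipschitz
    refine ⟨∑ k, ∑ j, ‖covMatrixInvSqrt φ k j‖₊ * L j, fun k => ?_⟩
    refine LipschitzWith.of_dist_le_mul fun u v => ?_
    rw [Real.dist_eq, standardScore, standardScore, ← Finset.sum_sub_distrib]
    calc |∑ j, (covMatrixInvSqrt φ k j * φ j u - covMatrixInvSqrt φ k j * φ j v)|
        ≤ ∑ j, |covMatrixInvSqrt φ k j| * L j * dist u v := by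
          refine (Finset.abs_sum_le_sum_abs _ _).trans (Finset.sum_le_sum fun j _ => ?_)
          rw [← mul_sub, abs_mul, mul_assoc]
          gcongr
          exact (hL j).dist_le_mul u v
      _ = (∑ j, ‖covMatrixInvSqrt φ k j‖₊ * L j : ℝ≥0) * dist u v := by
          rw [← Finset.sum_mul]
          push_cast
          rfl
      _ ≤ _ := by
          refine mul_le_mul_of_nonneg_right (NNReal.coe_le_coe.2 ?_) dist_nonneg
          exact Finset.single_le_sum
            (f := fun k => ∑ j, ‖covMatrixInvSqrt φ k j‖₊ * L j) (fun _ _ => zero_le)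
            (Finset.mem_univ k)
  integral_eq_zero k := by
    simp_rw [standardScore]
    rw [integral_finsetSum _ fun j _ => (integrable_unitInterval_of_continuous
      (hφ.continuous j)).const_mul _]
    simp [integral_const_mul, hφ.integral_eq_zero]
  integral_mul k l := by
    have h := dotProduct_covMatrix_mulVec hφ (covMatrixInvSqrt φ k) (covMatrixInvSqrt φ l)
    simp_rw [standardScore]
    rw [← h, ← Matrix.one_apply, ← covMatrixInvSqrt_mul_covMatrix_mul hφ, mul_assoc,
      Matrix.mul_apply]
    simp only [dotProduct, Matrix.mulVec, Matrix.mul_apply]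
    refine Finset.sum_congr rfl fun i _ => ?_
    congr 1
    exact Finset.sum_congr rfl fun j _ => by rw [covMatrixInvSqrt_isSymm φ l j]
  eq_zero_of_le k u hu := by
    simp [standardScore, eq_zero_of_le_tauMin hφ _ hu]
  eq_zero_of_ge k u hu := by
    simp [standardScore, eq_zero_of_tauMax_le hφ _ hu]

/-- The vector of products `ψ_k(u) ψ_l(v)`. -/
def productScore (ψ : Fin q → I → ℝ) (uv : I × I) : EuclideanSpace ℝ (Fin q × Fin q) :=
  WithLp.toLp 2 fun kl => ψ kl.1 uv.1 * ψ kl.2 uv.2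

/-- By symmetry of `Σ^(-1/2)` the two outer factors are absorbed into the scores; the factor `n⁻¹`
is the gap between averaging and normalizing by `√n`. -/
lemma frobeniusSq_standardized_empCorr (φ : Fin q → I → ℝ) {n : ℕ} (uv : Fin n → I × I) :
    frobeniusSq (covMatrixInvSqrt φ * empCorr φ uv * covMatrixInvSqrt φ) =
      (n : ℝ)⁻¹ * ‖normalizedSum (productScore (standardScore φ)) n uv‖ ^ 2 := by
  have hentry (k l : Fin q) : (covMatrixInvSqrt φ * empCorr φ uv * covMatrixInvSqrt φ) k l =
      (n : ℝ)⁻¹ * ∑ i, standardScore φ k (uv i).1 * standardScore φ l (uv i).2 := by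
    simp only [Matrix.mul_apply, empCorr, Matrix.of_apply, standardScore,
      Finset.mul_sum, Finset.sum_mul]
    conv_rhs => rw [Finset.sum_comm]
    refine Finset.sum_congr rfl fun j _ => ?_
    conv_rhs => rw [Finset.sum_comm]
    refine Finset.sum_congr rfl fun m _ => Finset.sum_congr rfl fun i _ => ?_
    rw [covMatrixInvSqrt_isSymm φ l j]
    ring
  have hcoord (kl : Fin q × Fin q) :
      (normalizedSum (productScore (standardScore φ)) n uv) kl = (√(n : ℝ))⁻¹ *
        ∑ i, standardScore φ kl.1 (uv i).1 * standardScore φ kl.2 (uv i).2 := by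
    simp [normalizedSum, productScore]
  rw [frobeniusSq, EuclideanSpace.norm_sq_eq, Fintype.sum_prod_type, Finset.mul_sum]
  refine Finset.sum_congr rfl fun k _ => ?_
  rw [Finset.mul_sum]
  refine Finset.sum_congr rfl fun l _ => ?_
  rw [hentry, hcoord, Real.norm_eq_abs, sq_abs, mul_pow, mul_pow, inv_pow, inv_pow,
    Real.sq_sqrt (by positivity)]
  ring

end Standardization

end Scores

/-! ### Gaussian limit of the oracle statistic, and bounds on the remainder. -/

section Approximation

open scoped RealInnerProductSpace

section ProductScore

variable {q : ℕ} {ψ : Fin q → I → ℝ} {τ₀ τ₁ : ℝ}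

lemma measurable_productScore (hψ : IsOrthonormalScore ψ τ₀ τ₁) : Measurable (productScore ψ) := by
  have := hψ.measurable
  unfold productScore
  fun_prop

lemma inner_productScore (uv : I × I) (t : EuclideanSpace ℝ (Fin q × Fin q)) :
    ⟪productScore ψ uv, t⟫ = ∑ kl : Fin q × Fin q, t kl * (ψ kl.1 uv.1 * ψ kl.2 uv.2) := by
  simp [PiLp.inner_apply, productScore]

lemma integral_inner_productScore (hψ : IsOrthonormalScore ψ τ₀ τ₁)
    (t : EuclideanSpace ℝ (Fin q × Fin q)) : ∫ uv, ⟪productScore ψ uv, t⟫ = 0 := by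
  have hi (k : Fin q) := integrable_unitInterval_of_continuous (hψ.continuous k)
  simp_rw [inner_productScore]
  rw [integral_finsetSum _ fun kl _ => ((hi kl.1).mul_prod (hi kl.2)).const_mul _]
  refine Finset.sum_eq_zero fun kl _ => ?_
  rw [integral_const_mul, Measure.volume_eq_prod, integral_prod_mul, hψ.integral_eq_zero]
  simp

/-- Under the uniform law on the square the product scores have identity covariance, as the central
limit theorem requires. -/
lemma integral_inner_productScore_sq (hψ : IsOrthonormalScore ψ τ₀ τ₁)
    (t : EuclideanSpace ℝ (Fin q × Fin q)) :
    ∫ uv, ⟪productScore ψ uv, t⟫ ^ 2 = ‖t‖ ^ 2 := by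
  have hi (k l : Fin q) :=
    integrable_unitInterval_of_continuous ((hψ.continuous k).mul (hψ.continuous l))
  have hterm (x y : Fin q × Fin q) (uv : I × I) :
      t x * (ψ x.1 uv.1 * ψ x.2 uv.2) * (t y * (ψ y.1 uv.1 * ψ y.2 uv.2)) =
      t x * t y * ((ψ x.1 uv.1 * ψ y.1 uv.1) * (ψ x.2 uv.2 * ψ y.2 uv.2)) := by ring
  have hint (x y : Fin q × Fin q) : Integrable (fun uv : I × I =>
      t x * t y * ((ψ x.1 uv.1 * ψ y.1 uv.1) * (ψ x.2 uv.2 * ψ y.2 uv.2))) volume :=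
    ((hi x.1 y.1).mul_prod (hi x.2 y.2)).const_mul _
  simp_rw [inner_productScore, sq, Finset.sum_mul_sum, hterm]
  rw [integral_finsetSum _ fun x _ => integrable_finsetSum _ fun y _ => hint x y]
  have hval (x y : Fin q × Fin q) : ∫ uv : I × I,
      t x * t y * ((ψ x.1 uv.1 * ψ y.1 uv.1) * (ψ x.2 uv.2 * ψ y.2 uv.2)) =
      if x = y then t x ^ 2 else 0 := by
    obtain ⟨k, l⟩ := x
    obtain ⟨k', l'⟩ := y
    rw [integral_const_mul, Measure.volume_eq_prod, integral_prod_mul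
      (fun u => ψ k u * ψ k' u) (fun v => ψ l v * ψ l' v), hψ.integral_mul,
      hψ.integral_mul]
    by_cases h1 : k = k'
    · by_cases h2 : l = l'
      · simp [h1, h2, sq]
      · simp [h2]
    · simp [h1]
  simp_rw [integral_finsetSum _ fun y _ => hint _ y, hval]
  rw [← sq, EuclideanSpace.norm_sq_eq]
  simp

end ProductScore

section Gaussian

variable {ι : Type*} [Fintype ι]

lemma map_norm_stdGaussian_singleton [Nonempty ι] (c : ℝ) :
    (stdGaussian (EuclideanSpace ℝ ι)).map norm {c} = 0 := by
  rw [Measure.map_apply measurable_norm (measurableSet_singleton c)]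
  have h := chiSq_singleton (Fintype.card_ne_zero (α := ι)) (c ^ 2)
  rw [chiSq_eq_map_stdGaussian rfl,
    Measure.map_apply (by fun_prop) (measurableSet_singleton _)] at h
  refine measure_mono_null (fun x hx => ?_) h
  have hx' : ‖x‖ = c := hx
  simp [hx']

lemma stdGaussian_real_lt_norm (r : ℝ) :
    (stdGaussian (EuclideanSpace ℝ ι)).real {x | r < ‖x‖} =
      1 - ((stdGaussian (EuclideanSpace ℝ ι)).map norm).real (Set.Iic r) := by
  have : IsProbabilityMeasure ((stdGaussian (EuclideanSpace ℝ ι)).map norm) :=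
    Measure.isProbabilityMeasure_map measurable_norm.aemeasurable
  rw [← probReal_compl_eq_one_sub measurableSet_Iic,
    map_measureReal_apply measurable_norm measurableSet_Iic.compl]
  congr 1
  ext x
  simp

lemma continuous_stdGaussian_real_lt_norm [Nonempty ι] :
    Continuous fun r => (stdGaussian (EuclideanSpace ℝ ι)).real {x | r < ‖x‖} := by
  have : IsProbabilityMeasure ((stdGaussian (EuclideanSpace ℝ ι)).map norm) :=
    Measure.isProbabilityMeasure_map measurable_norm.aemeasurable
  simp_rw [stdGaussian_real_lt_norm]
  exact continuous_const.sub (continuous_measureReal_Iic _ map_norm_stdGaussian_singleton)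

/-- Lévy's continuity theorem and the portmanteau theorem, since spheres are null for the Gaussian
limit. -/
lemma tendsto_real_lt_norm [Nonempty ι] {μ : ℕ → ProbabilityMeasure (EuclideanSpace ℝ ι)}
    (h : ∀ t, Tendsto (fun n => charFun (μ n : Measure (EuclideanSpace ℝ ι)) t) atTop
      (𝓝 (charFun (stdGaussian (EuclideanSpace ℝ ι)) t))) (r : ℝ) :
    Tendsto (fun n => (μ n : Measure (EuclideanSpace ℝ ι)).real {x | r < ‖x‖}) atTop
      (𝓝 ((stdGaussian (EuclideanSpace ℝ ι)).real {x | r < ‖x‖})) := by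
  have hw : Tendsto μ atTop (𝓝 ⟨stdGaussian (EuclideanSpace ℝ ι), inferInstance⟩) :=
    ProbabilityMeasure.tendsto_iff_tendsto_charFun.2 h
  have hfr : stdGaussian (EuclideanSpace ℝ ι) (frontier {x | r < ‖x‖}) = 0 := by
    have h0 := map_norm_stdGaussian_singleton (ι := ι) r
    rw [Measure.map_apply measurable_norm (measurableSet_singleton r)] at h0
    refine measure_mono_null (fun x hx => ?_) h0
    exact (frontier_lt_subset_eq continuous_const continuous_norm hx).symm
  have := ProbabilityMeasure.tendsto_measure_of_null_frontier_of_tendsto' hw hfr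
  exact (ENNReal.tendsto_toReal (measure_ne_top _ _)).comp this

lemma sqrt_lt_iff_lt_sq {x y : ℝ} (hx : 0 ≤ x) (hy : 0 ≤ y) : √x < y ↔ x < y ^ 2 := by
  rw [← Real.sqrt_lt_sqrt_iff hx, Real.sqrt_sq hy]

lemma stdGaussian_real_sqrt_quantile_lt_norm {m : ℕ} (hm : Fintype.card ι = m) (hm0 : m ≠ 0)
    {α : ℝ} (hα : α ∈ Set.Ioo (0 : ℝ) 1) :
    (stdGaussian (EuclideanSpace ℝ ι)).real {x | √(quantile (chiSq m) (1 - α)) < ‖x‖} = α := by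
  have hp : 1 - α ∈ Set.Ioo (0 : ℝ) 1 := ⟨by linarith [hα.2], by linarith [hα.1]⟩
  have hcdf := cdf_quantile (chiSq m) (chiSq_singleton hm0) hp
  have hset : {x : EuclideanSpace ℝ ι | √(quantile (chiSq m) (1 - α)) < ‖x‖} =
      (fun x => ‖x‖ ^ 2) ⁻¹' (Set.Iic (quantile (chiSq m) (1 - α)))ᶜ := by
    ext x
    simp [sqrt_lt_iff_lt_sq (quantile_chiSq_nonneg m hp.1) (norm_nonneg x)]
  rw [hset, ← map_measureReal_apply (by fun_prop) measurableSet_Iic.compl,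
    ← chiSq_eq_map_stdGaussian hm, probReal_compl_eq_one_sub measurableSet_Iic, ← cdf_eq_real,
    hcdf, sub_sub_cancel]

end Gaussian

section Remainder

variable {Ω 𝓤 𝓦 𝓦' : Type*} [MeasurableSpace Ω] [MeasurableSpace 𝓤] [MeasurableSpace 𝓦]
  [MeasurableSpace 𝓦']

/-- The weights are bounded by `B` only with high probability. Setting those that exceed `B` to zero
keeps them functions of the `W` sample, so Chebyshev's inequality applies to the truncated weights.
-/
lemma measure_pi_lt_abs_sum_mul_le_add {P : Measure Ω} [IsProbabilityMeasure P] {ν : Measure 𝓤}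
    [IsProbabilityMeasure ν] {U : Ω → 𝓤} {W : Ω → 𝓦} (hU : Measurable U) (hW : Measurable W)
    (hUW : P.map (fun w => (U w, W w)) = ν.prod (P.map W)) {ψ : 𝓤 → ℝ} (hψ : Measurable ψ)
    {K : ℝ} (hK : ∀ u, |ψ u| ≤ K) (h0 : ∫ u, ψ u ∂ν = 0) (h1 : ∫ u, ψ u ^ 2 ∂ν = 1) {n : ℕ}
    {b : (Fin n → 𝓦) → Fin n → ℝ} (hb : ∀ i, Measurable fun x => b x i) {B : ℝ} (hB : 0 ≤ B)
    {ε : ℝ} (hε : 0 < ε) :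
    (Measure.pi fun _ : Fin n => P)
      {s | ε < |(√(n : ℝ))⁻¹ * ∑ i, ψ (U (s i)) * b (fun i => W (s i)) i|} ≤
      (Measure.pi fun _ : Fin n => P) {s | ∃ i, B < |b (fun i => W (s i)) i|} +
        ENNReal.ofReal (B ^ 2 / ε ^ 2) := by
  let b' : (Fin n → 𝓦) → Fin n → ℝ := fun x i => if |b x i| ≤ B then b x i else 0
  have hb' (i : Fin n) : Measurable fun x => b' x i :=
    Measurable.ite (measurableSet_le (hb i).abs measurable_const) (hb i) measurable_const
  have hb'B (x : Fin n → 𝓦) (i : Fin n) : |b' x i| ≤ B := by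
    by_cases h : |b x i| ≤ B <;> simp [b', h, hB]
  refine le_trans ?_ (add_le_add_right
    (measure_pi_lt_abs_sum_mul_le hU hW hUW hψ hK h0 h1 hb' hb'B hε) _)
  refine (measure_mono fun s hs => ?_).trans (measure_union_le _ _)
  by_cases h : ∃ i, B < |b (fun i => W (s i)) i|
  · exact Or.inl h
  · right
    push Not at h
    simpa [b', h] using hs

/-- Expand `(f + a)(g + b) - f g = f b + g a + a b`. Each exceptional event is paid for twice, once
in a linear cross term and once in the product `a b`; hence the factors `2`. -/
lemma measure_pi_lt_abs_sum_perturbed_sub_le {P : Measure Ω} [IsProbabilityMeasure P]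
    {ν : Measure 𝓤} [IsProbabilityMeasure ν] {U U' : Ω → 𝓤} {W : Ω → 𝓦} {W' : Ω → 𝓦'}
    (hU : Measurable U) (hU' : Measurable U') (hW : Measurable W) (hW' : Measurable W')
    (hUW' : P.map (fun w => (U w, W' w)) = ν.prod (P.map W'))
    (hU'W : P.map (fun w => (U' w, W w)) = ν.prod (P.map W)) {f g : 𝓤 → ℝ}
    (hf : Measurable f) (hg : Measurable g) {K : ℝ} (hfK : ∀ u, |f u| ≤ K) (hgK : ∀ u, |g u| ≤ K)
    (hf0 : ∫ u, f u ∂ν = 0) (hg0 : ∫ u, g u ∂ν = 0) (hf1 : ∫ u, f u ^ 2 ∂ν = 1)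
    (hg1 : ∫ u, g u ^ 2 ∂ν = 1) {n : ℕ} {a : (Fin n → 𝓦) → Fin n → ℝ}
    {b : (Fin n → 𝓦') → Fin n → ℝ} (ha : ∀ i, Measurable fun x => a x i)
    (hb : ∀ i, Measurable fun x => b x i) {A B : ℝ} (hA : 0 ≤ A) (hB : 0 ≤ B) {ε : ℝ}
    (hε : 0 < ε) (hAB : √(n : ℝ) * A * B ≤ ε) :
    (Measure.pi fun _ : Fin n => P) {s | 3 * ε < |(√(n : ℝ))⁻¹ * ∑ i,
        ((f (U (s i)) + a (fun i => W (s i)) i) * (g (U' (s i)) + b (fun i => W' (s i)) i) -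
          f (U (s i)) * g (U' (s i)))|} ≤
      2 * (Measure.pi fun _ : Fin n => P) {s | ∃ i, A < |a (fun i => W (s i)) i|} +
      2 * (Measure.pi fun _ : Fin n => P) {s | ∃ i, B < |b (fun i => W' (s i)) i|} +
      (ENNReal.ofReal (A ^ 2 / ε ^ 2) + ENNReal.ofReal (B ^ 2 / ε ^ 2)) := by
  set μ := Measure.pi fun _ : Fin n => P
  have h1 := measure_pi_lt_abs_sum_mul_le_add hU hW' hUW' hf hfK hf0 hf1 hb hB hε
  have h2 := measure_pi_lt_abs_sum_mul_le_add hU' hW hU'W hg hgK hg0 hg1 ha hA hε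
  have hsub : {s : Fin n → Ω | 3 * ε < |(√(n : ℝ))⁻¹ * ∑ i,
        ((f (U (s i)) + a (fun i => W (s i)) i) * (g (U' (s i)) + b (fun i => W' (s i)) i) -
          f (U (s i)) * g (U' (s i)))|} ⊆
      ({s | ε < |(√(n : ℝ))⁻¹ * ∑ i, f (U (s i)) * b (fun i => W' (s i)) i|} ∪
        {s | ε < |(√(n : ℝ))⁻¹ * ∑ i, g (U' (s i)) * a (fun i => W (s i)) i|}) ∪
      ({s | ∃ i, A < |a (fun i => W (s i)) i|} ∪ {s | ∃ i, B < |b (fun i => W' (s i)) i|}) := by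
    intro s hs
    by_contra hcon
    simp only [Set.mem_union, Set.mem_ofPred_eq, not_or, not_lt, not_exists] at hcon
    obtain ⟨⟨hc1, hc2⟩, hc3, hc4⟩ := hcon
    have hc5 : |(√(n : ℝ))⁻¹ * ∑ i, a (fun i => W (s i)) i * b (fun i => W' (s i)) i| ≤ ε := by
      refine le_trans ?_ hAB
      rw [abs_mul, abs_of_nonneg (by positivity : 0 ≤ (√(n : ℝ))⁻¹)]
      calc (√(n : ℝ))⁻¹ * |∑ i, a (fun i => W (s i)) i * b (fun i => W' (s i)) i|
          ≤ (√(n : ℝ))⁻¹ * ∑ _i : Fin n, A * B := by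
            gcongr
            refine (Finset.abs_sum_le_sum_abs _ _).trans (Finset.sum_le_sum fun i _ => ?_)
            rw [abs_mul]
            exact mul_le_mul (hc3 i) (hc4 i) (abs_nonneg _) hA
        _ = √(n : ℝ) * A * B := by
            rw [Finset.sum_const, Finset.card_univ, Fintype.card_fin, nsmul_eq_mul, mul_assoc,
              ← mul_assoc (√(n : ℝ))⁻¹]
            congr 1
            rw [inv_mul_eq_div, Real.div_sqrt]
    have hsplit : (√(n : ℝ))⁻¹ * ∑ i,
        ((f (U (s i)) + a (fun i => W (s i)) i) * (g (U' (s i)) + b (fun i => W' (s i)) i) -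
          f (U (s i)) * g (U' (s i))) =
        (√(n : ℝ))⁻¹ * ∑ i, f (U (s i)) * b (fun i => W' (s i)) i +
        (√(n : ℝ))⁻¹ * ∑ i, g (U' (s i)) * a (fun i => W (s i)) i +
        (√(n : ℝ))⁻¹ * ∑ i, a (fun i => W (s i)) i * b (fun i => W' (s i)) i := by
      rw [← mul_add, ← mul_add, ← Finset.sum_add_distrib, ← Finset.sum_add_distrib]
      congr 1
      exact Finset.sum_congr rfl fun i _ => by ring
    have hs' := hs.out
    rw [hsplit] at hs'
    have := abs_add_three ((√(n : ℝ))⁻¹ * ∑ i, f (U (s i)) * b (fun i => W' (s i)) i)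
      ((√(n : ℝ))⁻¹ * ∑ i, g (U' (s i)) * a (fun i => W (s i)) i)
      ((√(n : ℝ))⁻¹ * ∑ i, a (fun i => W (s i)) i * b (fun i => W' (s i)) i)
    linarith
  refine (measure_mono hsub).trans ((measure_union_le _ _).trans ?_)
  refine (add_le_add ((measure_union_le _ _).trans (add_le_add h1 h2))
    (measure_union_le _ _)).trans (le_of_eq ?_)
  ring

end Remainder

end Approximation

/-! ### Uniform approximation under the null hypothesis. -/

section UniformLevel

section Residuals

variable {d : ℕ}

instance isProbabilityMeasure_iidLaw (P : ProbabilityMeasure (Obs d)) (n : ℕ) :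
    IsProbabilityMeasure (iidLaw P n) := by
  unfold iidLaw
  infer_instance

lemma measurable_obsX : Measurable (obsX : Obs d → I) := measurable_fst

lemma measurable_obsY : Measurable (obsY : Obs d → I) := measurable_fst.comp measurable_snd

/-- The nonparametric residual `F(V | Z)`. -/
def residualOf (V : Obs d → I) (κ : Kernel (Fin d → I) I) [IsMarkovKernel κ] (w : Obs d) : I :=
  condPIT κ (V w) (obsZ w)

lemma measurable_residualOf {V : Obs d → I} (hV : Measurable V) (κ : Kernel (Fin d → I) I)
    [IsMarkovKernel κ] : Measurable (residualOf V κ) :=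
  (measurable_condPIT κ).comp (hV.prodMk measurable_obsZ)

/-- Under conditional independence the pair of residuals is uniform on the unit square. -/
lemma map_residuals_eq_volume {P : ProbabilityMeasure (Obs d)} {V W : Obs d → I}
    (hV : Measurable V) (hW : Measurable W) {κ η : Kernel (Fin d → I) I} [IsMarkovKernel κ]
    [IsMarkovKernel η] (hκ : IsContCondDistrib P V κ) (hη : IsContCondDistrib P W η)
    (hind : CondIndepFun (MeasurableSpace.comap (obsZ : Obs d → Fin d → I) inferInstance)
      measurable_obsZ.comap_le V W (P : Measure (Obs d))) :
    (P : Measure (Obs d)).map (fun w => (residualOf V κ w, residualOf W η w)) = volume := by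
  have hZ := measurable_obsZ (d := d)
  have hU : Measurable fun w => condPIT κ (V w) (obsZ w) := measurable_residualOf hV κ
  have hU' : Measurable fun w => condPIT η (W w) (obsZ w) := measurable_residualOf hW η
  have h1 := map_condPIT_eq_prod hV hW hκ hind.symm
  have h2 := map_condPIT_eq_prod hW hV hη hind
  have hp : IsProbabilityMeasure ((P : Measure (Obs d)).map fun w => (V w, obsZ w)) :=
    Measure.isProbabilityMeasure_map (hV.prodMk hZ).aemeasurable
  have h3 : (P : Measure (Obs d)).map (residualOf W η) = volume := by
    have h := congrArg (Measure.map Prod.fst) h2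
    rw [Measure.map_fst_prod, measure_univ, one_smul,
      Measure.map_map measurable_fst (hU'.prodMk (hV.prodMk hZ))] at h
    exact h
  -- The first residual is independent of `(W, Z)`, hence of the second residual, which is a
  -- function of `(W, Z)`.
  have h4 := congrArg (Measure.map (Prod.map id fun p : I × (Fin d → I) => condPIT η p.1 p.2)) h1
  rw [Measure.map_map (measurable_id.prodMap (measurable_condPIT η))
    (hU.prodMk (hW.prodMk hZ)), ← Measure.map_prod_map _ _ measurable_id (measurable_condPIT η),
    Measure.map_map (measurable_condPIT η) (hW.prodMk hZ), Measure.map_id] at h4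
  have h5 : ((P : Measure (Obs d)).map
      ((fun p : I × (Fin d → I) => condPIT η p.1 p.2) ∘ fun w => (W w, obsZ w))) = volume := h3
  rw [h5] at h4
  exact h4

/-- The right side does not involve `P`: this is the source of uniformity in the limit theorem. -/
lemma map_iidLaw_normalizedSum_eq {E : Type*} [NormedAddCommGroup E] [InnerProductSpace ℝ E]
    [FiniteDimensional ℝ E] [MeasurableSpace E] [BorelSpace E] {P : ProbabilityMeasure (Obs d)}
    {R : Obs d → I × I} (hR : Measurable R) (hPR : (P : Measure (Obs d)).map R = volume)
    {S : I × I → E} (hS : Measurable S) (n : ℕ) :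
    (iidLaw P n).map (fun s => normalizedSum S n fun i => R (s i)) =
      (Measure.pi fun _ : Fin n => (volume : Measure (I × I))).map (normalizedSum S n) := by
  rw [← hPR, ← Measure.pi_map_pi fun _ => hR.aemeasurable,
    Measure.map_map (measurable_normalizedSum hS n) (by fun_prop)]
  rfl

lemma CDFEstimator.measurable_fit (E : CDFEstimator d) (n : ℕ) (i : Fin n) :
    Measurable fun x : Fin n → I × (Fin d → I) => E.toFun n x (x i).1 (x i).2 :=
  (E.measurable n).comp (measurable_id.prodMk (measurable_pi_apply i))

lemma measurable_residuals (EX EY : CDFEstimator d) (n : ℕ) (i : Fin n) :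
    Measurable fun s : Fin n → Obs d => residuals EX EY s i := by
  have hX := measurable_obsX (d := d)
  have hY := measurable_obsY (d := d)
  have hZ := measurable_obsZ (d := d)
  have h1 : Measurable fun s : Fin n → Obs d => fun i => (obsX (s i), obsZ (s i)) := by fun_prop
  have h2 : Measurable fun s : Fin n → Obs d => fun i => (obsY (s i), obsZ (s i)) := by fun_prop
  exact ((EX.measurable_fit n i).comp h1).prodMk ((EY.measurable_fit n i).comp h2)

variable {q : ℕ} {φ : Fin q → I → ℝ} {P₀ : Set (ProbabilityMeasure (Obs d))}

lemma UniformlyConsistent.exists_measure_le {V : Obs d → I}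
    {κ : ProbabilityMeasure (Obs d) → Kernel (Fin d → I) I} {E : CDFEstimator d} {g : ℕ → ℝ}
    (h : UniformlyConsistent φ P₀ V κ E g) (hκ : ∀ P ∈ P₀, IsContCondDistrib P V (κ P))
    (hτ : tauMin φ ≤ tauMax φ) (hτ₀ : tauMin φ ∈ I) (hτ₁ : tauMax φ ∈ I) {ψ : Fin q → I → ℝ}
    (hψ : IsOrthonormalScore ψ (tauMin φ) (tauMax φ)) {δ : ℝ} (hδ : 0 < δ) :
    ∃ C : ℝ, 0 < C ∧ ∀ n, 1 ≤ n → ∀ P ∈ P₀, ∀ [IsMarkovKernel (κ P)], ∀ k,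
      iidLaw P n {s | ∃ i, C * |g n| < |ψ k (E.fit V s (V (s i)) (obsZ (s i))) -
        ψ k (residualOf V (κ P) (s i))|} ≤ ENNReal.ofReal δ := by
  obtain ⟨L, hL⟩ := hψ.lipschitz
  obtain ⟨C, hC, hsup⟩ := h.consistent δ hδ
  -- `L + 1` instead of `L` keeps the constant positive when `L = 0`.
  refine ⟨(L + 1) * C, by positivity, fun n hn P hP _ k => ?_⟩
  have hle := le_trans (le_iSup₂_of_le n hn (le_iSup₂_of_le P hP le_rfl)) hsup.le
  refine (measure_mono fun s hs => ?_).trans hle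
  obtain ⟨i, hi⟩ := hs
  by_contra hcon
  refine absurd hi (not_lt.2 ?_)
  have hg := abs_pos.2 (h.rate_ne_zero n hn)
  have hcon' := (ENNReal.div_le_iff (by simpa using hg) ENNReal.ofReal_ne_top).1 (not_lt.1 hcon)
  rw [← ENNReal.ofReal_mul hC.le] at hcon'
  refine (abs_sub_le_of_supNormOn_le (hκ P hP).continuous hτ hτ₀ hτ₁ (hL k)
    (hψ.eq_zero_of_le k) (hψ.eq_zero_of_ge k) (fun z => E.monotone n _ z) (by positivity) hcon'
    (V (s i)) (obsZ (s i))).trans ?_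
  rw [mul_assoc]
  gcongr
  simp

end Residuals

section Slutsky

lemma EuclideanSpace_norm_le_sum_abs {ι : Type*} [Fintype ι] (x : EuclideanSpace ℝ ι) :
    ‖x‖ ≤ ∑ i, |x i| := by
  rw [EuclideanSpace.norm_eq]
  refine Real.sqrt_le_iff.2 ⟨Finset.sum_nonneg fun i _ => abs_nonneg _, ?_⟩
  exact Finset.sum_sq_le_sq_sum_of_nonneg fun i _ => abs_nonneg _

/-- If all `N` coordinates were at most `ε / (N + 1)`, the norm would be at most `ε N / (N + 1) <
ε`. The `+ 1` also covers an empty index set. -/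
lemma measure_lt_norm_le_sum {Ω ι : Type*} [MeasurableSpace Ω] [Fintype ι] (μ : Measure Ω)
    (D : Ω → EuclideanSpace ℝ ι) {ε : ℝ} (hε : 0 < ε) :
    μ {s | ε < ‖D s‖} ≤ ∑ i, μ {s | ε / (Fintype.card ι + 1) < |D s i|} := by
  refine le_trans (measure_mono fun s hs => ?_) (measure_iUnion_fintype_le μ _)
  by_contra hcon
  simp only [Set.mem_iUnion, Set.mem_ofPred_eq, not_exists, not_lt] at hcon
  have h1 : ‖D s‖ ≤ ∑ _i : ι, ε / (Fintype.card ι + 1) :=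
    (EuclideanSpace_norm_le_sum_abs _).trans (Finset.sum_le_sum fun i _ => hcon i)
  rw [Finset.sum_const, Finset.card_univ, nsmul_eq_mul, mul_div_assoc', mul_comm,
    le_div_iff₀ (by positivity)] at h1
  have hs' : ε < ‖D s‖ := hs
  nlinarith [(Nat.cast_nonneg (Fintype.card ι) : (0 : ℝ) ≤ Fintype.card ι)]

variable {Ω E : Type*} [MeasurableSpace Ω] [NormedAddCommGroup E]

/-- A quantitative Slutsky step, used below in both directions with the roles of `S` and `T`
exchanged. -/
lemma measureReal_lt_norm_le_add (μ : Measure Ω) [IsFiniteMeasure μ] (S T : Ω → E) (r ε : ℝ) :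
    μ.real {s | r + ε < ‖T s‖} ≤ μ.real {s | r < ‖S s‖} + μ.real {s | ε < ‖S s - T s‖} := by
  refine (measureReal_mono fun s hs => ?_).trans (measureReal_union_le _ _)
  by_contra hcon
  simp only [Set.mem_union, Set.mem_ofPred_eq, not_or, not_lt] at hcon
  have h1 : ‖T s‖ ≤ ‖S s‖ + ‖S s - T s‖ := norm_le_norm_add_norm_sub _ _
  have hs' : r + ε < ‖T s‖ := hs
  linarith [hcon.1, hcon.2]

end Slutsky

section UniformApproximation

variable {d q : ℕ} {φ : Fin q → I → ℝ} {P₀ : Set (ProbabilityMeasure (Obs d))}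
  {κX κY : ProbabilityMeasure (Obs d) → Kernel (Fin d → I) I} {EX EY : CDFEstimator d}
  {g h : ℕ → ℝ}

lemma eventually_measure_lt_abs_remainder_le (hq : 1 ≤ q) (hφ : IsScoreMap φ)
    (hκX : ∀ P ∈ P₀, IsContCondDistrib P obsX (κX P))
    (hκY : ∀ P ∈ P₀, IsContCondDistrib P obsY (κY P))
    (hEX : UniformlyConsistent φ P₀ obsX κX EX g) (hEY : UniformlyConsistent φ P₀ obsY κY EY h)
    (hgh : Tendsto (fun n : ℕ => √(n : ℝ) * g n * h n) atTop (𝓝 0)) {ψ : Fin q → I → ℝ}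
    (hψ : IsOrthonormalScore ψ (tauMin φ) (tauMax φ)) (k l : Fin q) {ε δ : ℝ} (hε : 0 < ε)
    (hδ : 0 < δ) :
    ∀ᶠ n in atTop, ∀ P ∈ nullHyp P₀, ∀ [IsMarkovKernel (κX P)] [IsMarkovKernel (κY P)],
      iidLaw P n {s | 3 * ε < |(√(n : ℝ))⁻¹ * ∑ i,
        (ψ k (residuals EX EY s i).1 * ψ l (residuals EX EY s i).2 -
          ψ k (residualOf obsX (κX P) (s i)) * ψ l (residualOf obsY (κY P) (s i)))|} ≤
      ENNReal.ofReal (6 * δ) := by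
  obtain ⟨hτ, hτ₀, hτ₁⟩ := tau_bounds hq hφ
  obtain ⟨C, hC, hXC⟩ := hEX.exists_measure_le hκX hτ hτ₀ hτ₁ hψ hδ
  obtain ⟨D, hD, hYD⟩ := hEY.exists_measure_le hκY hτ hτ₀ hτ₁ hψ hδ
  obtain ⟨K, hK⟩ := hψ.exists_abs_le
  have hA : Tendsto (fun n => (C * |g n|) ^ 2 / ε ^ 2) atTop (𝓝 0) := by
    simpa using ((hEX.rate_tendsto.abs.const_mul C).pow 2).div_const (ε ^ 2)
  have hB : Tendsto (fun n => (D * |h n|) ^ 2 / ε ^ 2) atTop (𝓝 0) := by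
    simpa using ((hEY.rate_tendsto.abs.const_mul D).pow 2).div_const (ε ^ 2)
  have hAB : Tendsto (fun n : ℕ => √(n : ℝ) * (C * |g n|) * (D * |h n|)) atTop (𝓝 0) := by
    have := hgh.abs.const_mul (C * D)
    rw [abs_zero, mul_zero] at this
    refine this.congr fun n => ?_
    rw [abs_mul, abs_mul, abs_of_nonneg (Real.sqrt_nonneg _)]
    ring
  filter_upwards [eventually_ge_atTop 1, hA.eventually (ge_mem_nhds hδ),
    hB.eventually (ge_mem_nhds hδ), hAB.eventually (ge_mem_nhds hε)] with n hn hAn hBn hABn P hP _ _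
  have hX := measurable_obsX (d := d)
  have hY := measurable_obsY (d := d)
  have hZ := measurable_obsZ (d := d)
  -- `a` is a function of the `(X, Z)` sample alone, and `b` of the `(Y, Z)` sample alone; the
  -- independence argument rests on this separation.
  let a : (Fin n → I × (Fin d → I)) → Fin n → ℝ := fun x i =>
    ψ k (EX.toFun n x (x i).1 (x i).2) - ψ k (condPIT (κX P) (x i).1 (x i).2)
  let b : (Fin n → I × (Fin d → I)) → Fin n → ℝ := fun x i =>
    ψ l (EY.toFun n x (x i).1 (x i).2) - ψ l (condPIT (κY P) (x i).1 (x i).2)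
  have ha (i : Fin n) : Measurable fun x => a x i :=
    ((hψ.measurable k).comp (EX.measurable_fit n i)).sub
      ((hψ.measurable k).comp ((measurable_condPIT (κX P)).comp (measurable_pi_apply i)))
  have hb (i : Fin n) : Measurable fun x => b x i :=
    ((hψ.measurable l).comp (EY.measurable_fit n i)).sub
      ((hψ.measurable l).comp ((measurable_condPIT (κY P)).comp (measurable_pi_apply i)))
  have key := measure_pi_lt_abs_sum_perturbed_sub_le (P := (P : Measure (Obs d)))
    (measurable_residualOf hX (κX P)) (measurable_residualOf hY (κY P)) (hX.prodMk hZ)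
    (hY.prodMk hZ) (map_condPIT_eq_prod hX hY (hκX P hP.1) hP.2.symm)
    (map_condPIT_eq_prod hY hX (hκY P hP.1) hP.2) (hψ.measurable k) (hψ.measurable l) (hK k)
    (hK l) (hψ.integral_eq_zero k) (hψ.integral_eq_zero l) (hψ.integral_sq k) (hψ.integral_sq l)
    ha hb (by positivity) (by positivity) hε hABn
  have hset : {s : Fin n → Obs d | 3 * ε < |(√(n : ℝ))⁻¹ * ∑ i,
        (ψ k (residuals EX EY s i).1 * ψ l (residuals EX EY s i).2 -
          ψ k (residualOf obsX (κX P) (s i)) * ψ l (residualOf obsY (κY P) (s i)))|} =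
      {s | 3 * ε < |(√(n : ℝ))⁻¹ * ∑ i, ((ψ k (residualOf obsX (κX P) (s i)) +
        a (fun i => (obsX (s i), obsZ (s i))) i) * (ψ l (residualOf obsY (κY P) (s i)) +
        b (fun i => (obsY (s i), obsZ (s i))) i) -
          ψ k (residualOf obsX (κX P) (s i)) * ψ l (residualOf obsY (κY P) (s i)))|} := by
    ext s
    simp only [a, b, residualOf, residuals, CDFEstimator.fit, add_sub_cancel]
  rw [hset]
  refine key.trans ?_
  have h6 : ENNReal.ofReal (6 * δ) = 2 * ENNReal.ofReal δ + 2 * ENNReal.ofReal δ +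
      (ENNReal.ofReal δ + ENNReal.ofReal δ) := by
    rw [ENNReal.ofReal_mul (by norm_num)]
    norm_num
    ring
  rw [h6]
  gcongr
  · exact hXC n hn P hP.1 k
  · exact hYD n hn P hP.1 l

/-- Under the null hypothesis, the normalized sum over the estimated residuals is uniformly close
to one over independent uniform random variables. -/
lemma eventually_exists_approximation (hq : 1 ≤ q) (hφ : IsScoreMap φ)
    (hκX : ∀ P ∈ P₀, IsContCondDistrib P obsX (κX P))
    (hκY : ∀ P ∈ P₀, IsContCondDistrib P obsY (κY P))
    (hEX : UniformlyConsistent φ P₀ obsX κX EX g) (hEY : UniformlyConsistent φ P₀ obsY κY EY h)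
    (hgh : Tendsto (fun n : ℕ => √(n : ℝ) * g n * h n) atTop (𝓝 0)) {ψ : Fin q → I → ℝ}
    (hψ : IsOrthonormalScore ψ (tauMin φ) (tauMax φ)) {ε δ : ℝ} (hε : 0 < ε) (hδ : 0 < δ) :
    ∀ᶠ n in atTop, ∀ P ∈ nullHyp P₀,
      ∃ S : (Fin n → Obs d) → EuclideanSpace ℝ (Fin q × Fin q), Measurable S ∧
        (iidLaw P n).map S = (Measure.pi fun _ : Fin n => (volume : Measure (I × I))).map
          (normalizedSum (productScore ψ) n) ∧
        (iidLaw P n).real {s | ε < ‖normalizedSum (productScore ψ) n (residuals EX EY s) - S s‖} ≤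
          δ := by
  set N : ℝ := Fintype.card (Fin q × Fin q) + 1 with hN
  have hN0 : 0 < N := by positivity
  -- The divisors `3` and `6` cancel the constants of the coordinatewise bound; `N = q² + 1` pays
  -- for the passage from coordinates to the norm.
  have hcomp : ∀ kl : Fin q × Fin q, _ := fun kl =>
    eventually_measure_lt_abs_remainder_le hq hφ hκX hκY hEX hEY hgh hψ kl.1 kl.2
      (ε := ε / N / 3) (δ := δ / N / 6) (by positivity) (by positivity)
  filter_upwards [eventually_all.2 hcomp] with n hn P hP
  have := (hκX P hP.1).markov
  have := (hκY P hP.1).markov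
  have hU := measurable_residualOf measurable_obsX (κX P)
  have hU' := measurable_residualOf measurable_obsY (κY P)
  have hV := measurable_productScore hψ
  refine ⟨fun s => normalizedSum (productScore ψ) n
    fun i => (residualOf obsX (κX P) (s i), residualOf obsY (κY P) (s i)),
    (measurable_normalizedSum hV n).comp (by fun_prop),
    map_iidLaw_normalizedSum_eq (hU.prodMk hU') (map_residuals_eq_volume measurable_obsX
      measurable_obsY (hκX P hP.1) (hκY P hP.1) hP.2) hV n, ?_⟩
  rw [measureReal_def]
  refine ENNReal.toReal_le_of_le_ofReal hδ.le ((measure_lt_norm_le_sum _ _ hε).trans ?_)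
  have hkl (kl : Fin q × Fin q) : iidLaw P n {s | ε / N <
      |(normalizedSum (productScore ψ) n (residuals EX EY s) - normalizedSum (productScore ψ) n
        fun i => (residualOf obsX (κX P) (s i), residualOf obsY (κY P) (s i))) kl|} ≤
      ENNReal.ofReal (δ / N) := by
    have h1 := hn kl P hP
    rw [mul_div_cancel₀ _ (by norm_num : (3 : ℝ) ≠ 0),
      mul_div_cancel₀ _ (by norm_num : (6 : ℝ) ≠ 0)] at h1
    convert h1 using 6 with s
    simp [normalizedSum, productScore, mul_sub, Finset.mul_sum, Finset.sum_sub_distrib]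
  refine (Finset.sum_le_sum fun kl _ => hkl kl).trans ?_
  rw [Finset.sum_const, Finset.card_univ, ← ENNReal.ofReal_nsmul]
  refine ENNReal.ofReal_le_ofReal ?_
  rw [nsmul_eq_mul, mul_div_assoc', div_le_iff₀ hN0]
  nlinarith

/-- The positive factor `n⁻¹` cancels, and square roots may be taken because the critical value is
nonnegative. -/
lemma integral_test_eq (hφ : IsScoreMap φ) {α : ℝ} (hα : α < 1) (EX EY : CDFEstimator d)
    (P : ProbabilityMeasure (Obs d)) {n : ℕ} (hn : 1 ≤ n) :
    ∫ s, test φ EX EY α s ∂(iidLaw P n) = (iidLaw P n).real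
      {s | √(quantile (chiSq (q ^ 2)) (1 - α)) <
        ‖normalizedSum (productScore (standardScore φ)) n (residuals EX EY s)‖} := by
  have hψ := isOrthonormalScore_standardScore hφ
  set S : (Fin n → Obs d) → EuclideanSpace ℝ (Fin q × Fin q) :=
    fun s => normalizedSum (productScore (standardScore φ)) n (residuals EX EY s)
  have hS : Measurable S := (measurable_normalizedSum (measurable_productScore hψ) n).comp
    (measurable_pi_lambda _ fun i => measurable_residuals EX EY n i)
  have hms : MeasurableSet {s | √(quantile (chiSq (q ^ 2)) (1 - α)) < ‖S s‖} :=
    measurableSet_lt measurable_const hS.norm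
  rw [← integral_indicator_one hms]
  congr 1
  ext s
  have hn' : (0 : ℝ) < (n : ℝ)⁻¹ := by positivity
  have hiff : (n : ℝ)⁻¹ * quantile (chiSq (q ^ 2)) (1 - α) < testStat φ EX EY s ↔
      √(quantile (chiSq (q ^ 2)) (1 - α)) < ‖S s‖ := by
    rw [testStat, frobeniusSq_standardized_empCorr, mul_lt_mul_iff_right₀ hn',
      sqrt_lt_iff_lt_sq (quantile_chiSq_nonneg _ (by linarith)) (norm_nonneg _)]
  by_cases hs : √(quantile (chiSq (q ^ 2)) (1 - α)) < ‖S s‖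
  · rw [test, if_pos (hiff.2 hs), Set.indicator_of_mem (by exact hs)]
    rfl
  · rw [test, if_neg (hiff.not.2 hs), Set.indicator_of_notMem (by exact hs)]

/-- The rejection probabilities converge to the level, uniformly over the null hypothesis. -/
lemma eventually_abs_integral_test_sub_le (hq : 1 ≤ q) (hφ : IsScoreMap φ)
    {α : ℝ} (hα : α ∈ Set.Ioo (0 : ℝ) 1)
    (hκX : ∀ P ∈ P₀, IsContCondDistrib P obsX (κX P))
    (hκY : ∀ P ∈ P₀, IsContCondDistrib P obsY (κY P))
    (hEX : UniformlyConsistent φ P₀ obsX κX EX g) (hEY : UniformlyConsistent φ P₀ obsY κY EY h)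
    (hgh : Tendsto (fun n : ℕ => √(n : ℝ) * g n * h n) atTop (𝓝 0)) {δ : ℝ} (hδ : 0 < δ) :
    ∀ᶠ n in atTop, ∀ P ∈ nullHyp P₀, |∫ s, test φ EX EY α s ∂(iidLaw P n) - α| ≤ 3 * δ := by
  have hψ := isOrthonormalScore_standardScore hφ
  have hV := measurable_productScore hψ
  have : Nonempty (Fin q × Fin q) := ⟨(⟨0, hq⟩, ⟨0, hq⟩)⟩
  set r := √(quantile (chiSq (q ^ 2)) (1 - α)) with hr
  set γ := stdGaussian (EuclideanSpace ℝ (Fin q × Fin q))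
  have hγ : γ.real {x | r < ‖x‖} = α :=
    stdGaussian_real_sqrt_quantile_lt_norm (by simp [sq]) (by positivity) hα
  -- Of the total `3 * δ`, one `δ` pays for moving the threshold from `r` to `r ± ε`, one for the
  -- Gaussian limit at these two fixed thresholds, and one for the approximation by the oracle sum.
  obtain ⟨ε', hε', hcont⟩ := Metric.continuous_iff.1
    (continuous_stdGaussian_real_lt_norm (ι := Fin q × Fin q)) r δ hδ
  set ε := ε' / 2 with hεdef
  have hε : 0 < ε := half_pos hε'
  have hhi : |γ.real {x | r + ε < ‖x‖} - α| < δ := by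
    have := hcont (r + ε) (by rw [Real.dist_eq, add_sub_cancel_left, abs_of_pos hε]; linarith)
    rwa [Real.dist_eq, hγ] at this
  have hlo : |γ.real {x | r - ε < ‖x‖} - α| < δ := by
    have := hcont (r - ε) (by
      rw [Real.dist_eq, sub_sub_cancel_left, abs_neg, abs_of_pos hε]; linarith)
    rwa [Real.dist_eq, hγ] at this
  let ν : ℕ → ProbabilityMeasure (EuclideanSpace ℝ (Fin q × Fin q)) := fun n =>
    ⟨(Measure.pi fun _ : Fin n => (volume : Measure (I × I))).map
      (normalizedSum (productScore (standardScore φ)) n),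
      Measure.isProbabilityMeasure_map (measurable_normalizedSum hV n).aemeasurable⟩
  have hconv := tendsto_real_lt_norm (μ := ν) (tendsto_charFun_normalizedSum volume hV
    (integral_inner_productScore hψ) (integral_inner_productScore_sq hψ))
  have hnear (ρ : ℝ) : ∀ᶠ n in atTop, |(ν n : Measure (EuclideanSpace ℝ (Fin q × Fin q))).real {x | ρ < ‖x‖} -
      γ.real {x | ρ < ‖x‖}| < δ := by
    filter_upwards [(hconv ρ).eventually (Metric.ball_mem_nhds _ hδ)] with n hn
    exact hn
  filter_upwards [eventually_ge_atTop 1, hnear (r + ε), hnear (r - ε),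
    eventually_exists_approximation hq hφ hκX hκY hEX hEY hgh hψ hε hδ] with n hn hn1 hn2 hn3 P hP
  obtain ⟨S, hS, hlaw, hrem⟩ := hn3 P hP
  have hSν (ρ : ℝ) : (iidLaw P n).real {s | ρ < ‖S s‖} =
      (ν n : Measure (EuclideanSpace ℝ (Fin q × Fin q))).real {x | ρ < ‖x‖} := by
    change _ = ((Measure.pi fun _ : Fin n => (volume : Measure (I × I))).map
      (normalizedSum (productScore (standardScore φ)) n)).real _
    rw [← hlaw, map_measureReal_apply hS (measurableSet_lt measurable_const measurable_norm)]
    rfl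
  rw [integral_test_eq hφ hα.2 EX EY P hn]
  have h1 := measureReal_lt_norm_le_add (iidLaw P n)
    (fun s => normalizedSum (productScore (standardScore φ)) n (residuals EX EY s)) S r ε
  have h2 := measureReal_lt_norm_le_add (iidLaw P n) S
    (fun s => normalizedSum (productScore (standardScore φ)) n (residuals EX EY s)) (r - ε) ε
  simp_rw [norm_sub_rev (S _), sub_add_cancel] at h2
  rw [hSν] at h1 h2
  rw [abs_lt] at hn1 hn2 hhi hlo
  rw [abs_le]
  constructor <;> linarith [hn1.1, hn1.2, hn2.1, hn2.2, hhi.1, hhi.2, hlo.1, hlo.2]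

end UniformApproximation

end UniformLevel

end PartialCopula

end

/-! ### The theorem. -/

open PartialCopula
theorem corollary4p13 (d q : ℕ) (hq : 1 ≤ q)
    (φ : Fin q → I → ℝ) (hφ : IsScoreMap φ)
    (α : ℝ) (hα : α ∈ Set.Ioo (0 : ℝ) 1)
    (P₀ : Set (ProbabilityMeasure (Obs d)))
    (hP₀ : ∀ P ∈ P₀, (P : Measure (Obs d)) ≪ volume)
    (hH₀ : (nullHyp P₀).Nonempty)
    (κX κY : ProbabilityMeasure (Obs d) → ProbabilityTheory.Kernel (Fin d → I) I)
    (hκX : ∀ P ∈ P₀, IsContCondDistrib P obsX (κX P))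
    (hκY : ∀ P ∈ P₀, IsContCondDistrib P obsY (κY P))
    (EX EY : CDFEstimator d) (g h : ℕ → ℝ)
    (hEX : UniformlyConsistent φ P₀ obsX κX EX g)
    (hEY : UniformlyConsistent φ P₀ obsY κY EY h)
    (hgh : Tendsto (fun n : ℕ => √(n : ℝ) * g n * h n) atTop (𝓝 0)) :
    limsup (fun n : ℕ => ⨆ P : nullHyp P₀, ∫ s, test φ EX EY α s ∂(iidLaw (P : ProbabilityMeasure (Obs d)) n)) atTop = α := by
  have : Nonempty (nullHyp P₀) := hH₀.to_subtype
  -- The suprema in fact converge to `α`. Uniform closeness bounds them above, and any single member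
  -- of the nonempty null hypothesis bounds them below.
  refine Tendsto.limsup_eq (Metric.tendsto_atTop'.2 fun ε hε => ?_)
  have hev := eventually_abs_integral_test_sub_le hq hφ hα hκX hκY hEX hEY hgh
    (δ := ε / 6) (by positivity)
  obtain ⟨N, hN⟩ := eventually_atTop.1 hev
  refine ⟨N, fun n hn => ?_⟩
  have hb (P : nullHyp P₀) := abs_le.1 (hN n hn.le P P.2)
  obtain ⟨P, hP⟩ := hH₀
  have hup (P : nullHyp P₀) : ∫ s, test φ EX EY α s ∂(iidLaw (P : ProbabilityMeasure (Obs d)) n) ≤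
      α + 3 * (ε / 6) := by linarith [(hb P).2]
  have h1 := ciSup_le hup
  have h2 := le_ciSup ⟨_, Set.forall_mem_range.2 hup⟩ ⟨P, hP⟩
  have h3 := (hb ⟨P, hP⟩).1
  rw [Real.dist_eq, abs_lt]
  constructor <;> linarith
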